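/- Let $n\ge 1$. A cube $Q\subset\mathbb R^n$ is a compact cube with sides parallel to the coordinate axes, $c(Q)$ is its centre, $\ell(Q)>0$ its side length, $|Q|=\ell(Q)^n$, and for $\varphi:\mathbb R^n\times(0,\infty)\to(0,\infty)$ we write $\varphi(Q)=\varphi(c(Q),\ell(Q))$. For a measurable function $f$ and $0<q<\infty$ put $$\|f\|_{\mathcal M_{q,\varphi}}=\sup_{Q}\frac1{\varphi(Q)}\Big(\frac1{|Q|}\int_Q|f(y)|^q\,dy\Big)^{1/q},$$ with the average replaced by $\|f\|_{L^\infty(Q)}$ when $q=\infty$; $\mathcal M_{q,\varphi}(\mathbb R^n)$ is the set of measurable $f$ with $\|f\|_{\mathcal M_{q,\varphi}}<\infty$. For $f\in\mathcal S'(\mathbb R^n)$ put $$\|f\|_{H\mathcal M_{p,\varphi}}=\Big\|\sup_{t>0}|e^{t\Delta}f|\Big\|_{\mathcal M_{p,\varphi}},$$ where $e^{t\Delta}f(x)=\big\langle f,(4\pi t)^{-n/2}\exp(-|x-\cdot|^2/(4t))\big\rangle$, and let $H\mathcal M_{p,\varphi}(\mathbb R^n)$ be the set of $f\in\mathcal S'(\mathbb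 R^n)$ with $\sup_{t>0}|e^{t\Delta}f|\in\mathcal M_{p,\varphi}(\mathbb R^n)$. Let $\mathcal G_1$ be the class of functions $\varphi:\mathbb R^n\times(0,\infty)\to(0,\infty)$ such that $\varphi(x,r)\le\varphi(x,s)$ for all $x$ and $0<s\le r$, and such that for some constant $C$ $$\varphi(y,s)\,s^{n}\le C\,\varphi(x,r)\,r^{n}\qquad\text{whenever } r,s>0,\ x,y\in\mathbb R^n,\ \|x-y\|_\infty\le r-s .$$ **Theorem 1.2.** Let $0<p\le1$, let $d\ge n/p-n$ be real, and let $q\in[1,\infty]\cap(p,\infty]$. Let $\varphi,\eta\in\mathcal G_1$ satisfy, for some constant $C$, $$\int_r^\infty\frac{\varphi(x,s)}{\eta(x,s)\,s}\,ds\le C\,\frac{\varphi(x,r)}{\eta(x,r)}\qquad(x\in\mathbb R^n,\ r>0).$$ Then there is a constant $C'>0$, depending only on $n,p,d,q,\varphi,\eta$, such that the following holds. Let $\{Q_j\}_{j=1}^\infty$ be cubes, $\{a_j\}_{j=1}^\infty\subset\mathcal M_{q,\eta}(\mathbb R^n)$ complex-valued functions and $\{\lambda_j\}_{j=1}^\infty\subset[0,\infty)$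 such that $$\Big\|\Big(\sum_{j=1}^\infty(\lambda_j\chi_{Q_j})^p\Big)^{1/p}\Big\|_{\mathcal M_{p,\varphi}}<\infty,$$ and such that for every $j$ $$\|a_j\|_{\mathcal M_{q,\eta}}\le\frac1{\eta(Q_j)},\qquad \operatorname{supp}(a_j)\subset Q_j,\qquad \int_{Q_j}a_j(x)\,x^\alpha\,dx=0\ \text{ for all multi-indices } |\alpha|\le d .$$ Then $f=\sum_{j=1}^\infty\lambda_ja_j$ converges in $\mathcal S'(\mathbb R^n)$, belongs to $H\mathcal M_{p,\varphi}(\mathbb R^n)$, and $$\|f\|_{H\mathcal M_{p,\varphi}}\le C'\,\Big\|\Big(\sum_{j=1}^\infty(\lambda_j\chi_{Q_j})^p\Big)^{1/p}\Big\|_{\mathcal M_{p,\varphi}} .$$ -/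

import Mathlib

open MeasureTheory Filter Topology
open scoped ENNReal SchwartzMap

noncomputable section

namespace HardyMorrey

/-- The Euclidean space `ℝⁿ`. -/
abbrev Rn (n : ℕ) : Type := EuclideanSpace ℝ (Fin n)

/-- A compact cube with sides parallel to the coordinate axes, given by its centre and its
(positive) side length. -/
structure Cube (n : ℕ) where
  /-- the centre `c(Q)` -/
  center : Rn n
  /-- the side length `ℓ(Q)` -/
  side : ℝ
  side_pos : 0 < side

/-- The set of points of a cube. -/
def Cube.toSet {n : ℕ} (Q : Cube n) : Set (Rn n) :=
  {y | ∀ i, |y i - Q.center i| ≤ Q.side / 2}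

/-- The class `𝒢_p` of functions `φ : ℝⁿ × (0, ∞) → (0, ∞)`; only the values `φ x r` with `0 < r`
matter. The field `growth` with `y = x` says that `t ↦ t ^ (n / p) * φ x t` is almost increasing,
uniformly in `x`; for `y ≠ x` it compares nested cubes with different centres. The norm in it is the
sup norm of `Fin n → ℝ`. -/
structure GClass {n : ℕ} (p : ℝ) (φ : Rn n → ℝ → ℝ) : Prop where
  pos : ∀ x r, 0 < r → 0 < φ x r
  anti : ∀ x s r, 0 < s → s ≤ r → φ x r ≤ φ x s
  growth : ∃ C : ℝ, ∀ (x y : Rn n) (s r : ℝ), 0 < s → 0 < r →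
    ‖(x - y).ofLp‖ ≤ r - s → φ y s * s ^ ((n : ℝ) / p) ≤ C * (φ x r * r ^ ((n : ℝ) / p))

/-- The generalized Morrey norm
`sup_Q φ(Q)⁻¹ (|Q|⁻¹ ∫_Q |f|^p)^(1/p)`, where `φ(Q) = φ(c(Q), ℓ(Q))`; for `p = ∞` the average is the
essential supremum of `|f|` over `Q`. The values of `f` may be complex, or in `[0, ∞]`. -/
def morreyNorm {n : ℕ} {ε : Type*} [ENorm ε] (p : ℝ≥0∞) (φ : Rn n → ℝ → ℝ) (f : Rn n → ε) : ℝ≥0∞ :=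
  ⨆ Q : Cube n, eLpNorm f p ((volume Q.toSet)⁻¹ • volume.restrict Q.toSet) /
    ENNReal.ofReal (φ Q.center Q.side)

/-- Membership in the generalized Morrey space `ℳ_{p,φ}(ℝⁿ)`. -/
def MemMorrey {n : ℕ} {ε : Type*} [TopologicalSpace ε] [ENorm ε] (p : ℝ≥0∞) (φ : Rn n → ℝ → ℝ)
    (f : Rn n → ε) : Prop :=
  AEStronglyMeasurable f volume ∧ morreyNorm p φ f < ∞

section Gaussian

lemma pow_mul_exp_neg_sq_le {b : ℝ} (hb : 0 < b) (m : ℕ) {r : ℝ} (hr : 0 ≤ r) :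
    (1 + r) ^ m * Real.exp (-b * r ^ 2) ≤ m.factorial * Real.exp (1 + 1 / (4 * b)) := by
  have h1 : (1 + r) ^ m ≤ m.factorial * Real.exp (1 + r) := by
    have := Real.pow_div_factorial_le_exp (1 + r) (by positivity) m
    rwa [div_le_iff₀' (by positivity)] at this
  have h2 : 1 + r + -b * r ^ 2 ≤ 1 + 1 / (4 * b) := by
    have h3 : 1 / (4 * b) - r + b * r ^ 2 = (2 * b * r - 1) ^ 2 / (4 * b) := by
      field_simp
      ring
    have h4 : 0 ≤ (2 * b * r - 1) ^ 2 / (4 * b) := by positivity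
    linarith
  calc (1 + r) ^ m * Real.exp (-b * r ^ 2)
      ≤ m.factorial * Real.exp (1 + r) * Real.exp (-b * r ^ 2) := by gcongr
    _ = m.factorial * Real.exp (1 + r + -b * r ^ 2) := by rw [mul_assoc, ← Real.exp_add]
    _ ≤ _ := by gcongr

lemma gaussian_decay {n : ℕ} {b : ℝ} (hb : 0 < b) (k m : ℕ) :
    ∃ C : ℝ, ∀ x : Rn n,
      ‖x‖ ^ k * ‖iteratedFDeriv ℝ m (fun y : Rn n => Real.exp (-b * ‖y‖ ^ 2)) x‖ ≤ C := by
  obtain ⟨K, C, hC, h⟩ :=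
    (Function.hasTemperateGrowth_norm_sq (Rn n)).norm_iteratedFDeriv_le_uniform m
  let A : ℝ := ∑ i ∈ Finset.range (m + 1), b ^ i
  have hA : 0 ≤ A := Finset.sum_nonneg fun i _ => by positivity
  refine ⟨m.factorial * A * (1 + C) ^ m *
    ((k + K * m).factorial * Real.exp (1 + 1 / (4 * b))), fun x => ?_⟩
  have hx : (1 : ℝ) ≤ 1 + ‖x‖ := by linarith [norm_nonneg x]
  have hD : (1 : ℝ) ≤ (1 + C) * (1 + ‖x‖) ^ K :=
    one_le_mul_of_one_le_of_one_le (by linarith) (one_le_pow₀ hx)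
  have key := norm_iteratedFDeriv_comp_le (𝕜 := ℝ) (n := m) (N := (⊤ : ℕ∞))
    (g := fun s : ℝ => Real.exp (-b * s)) (f := fun y : Rn n => ‖y‖ ^ 2)
    (by fun_prop) (contDiff_norm_sq ℝ) (by exact_mod_cast le_top) x
    (C := A * Real.exp (-b * ‖x‖ ^ 2)) (D := (1 + C) * (1 + ‖x‖) ^ K)
    (by
      intro i hi
      rw [norm_iteratedFDeriv_eq_norm_iteratedDeriv, iteratedDeriv_exp_const_mul]
      simp only [norm_mul, norm_pow, norm_neg, Real.norm_eq_abs, abs_of_pos hb, Real.abs_exp]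
      gcongr
      exact Finset.single_le_sum (f := fun i => b ^ i) (fun i _ => by positivity)
        (Finset.mem_range.2 (by omega)))
    (by
      intro i hi him
      calc _ ≤ C * (1 + ‖x‖) ^ K := h i him x
        _ ≤ (1 + C) * (1 + ‖x‖) ^ K := by gcongr; linarith
        _ ≤ _ := le_self_pow₀ hD (by omega))
  calc _ ≤ (1 + ‖x‖) ^ k * (m.factorial * (A * Real.exp (-b * ‖x‖ ^ 2)) *
          ((1 + C) * (1 + ‖x‖) ^ K) ^ m) := by
        gcongr
        · linarith
        · exact key
    _ = m.factorial * A * (1 + C) ^ m *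
          ((1 + ‖x‖) ^ (k + K * m) * Real.exp (-b * ‖x‖ ^ 2)) := by
        rw [mul_pow, ← pow_mul, pow_add]
        ring
    _ ≤ _ := by
        exact mul_le_mul_of_nonneg_left (pow_mul_exp_neg_sq_le hb _ (norm_nonneg x)) (by positivity)

/-- The Gaussian `y ↦ exp (-b |y|²)`, `b > 0`, as a Schwartz function. -/
def gaussian (n : ℕ) {b : ℝ} (hb : 0 < b) : 𝓢(Rn n, ℂ) :=
  SchwartzMap.postcompCLM (𝕜 := ℝ) Complex.ofRealCLM
    { toFun := fun y : Rn n => Real.exp (-b * ‖y‖ ^ 2)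
      smooth' := Real.contDiff_exp.comp (contDiff_const.mul (contDiff_norm_sq ℝ))
      decay' := gaussian_decay hb }

end Gaussian

/-- The function `y ↦ (4πt)^(-n/2) exp (-|x - y|² / (4t))`, `t > 0`, as a Schwartz function. -/
def heatKernel {n : ℕ} {t : ℝ} (ht : 0 < t) (x : Rn n) : 𝓢(Rn n, ℂ) :=
  ((1 / Real.sqrt ((4 * Real.pi * t) ^ n) : ℝ) : ℂ) •
    (gaussian n (b := 1 / (4 * t)) (by positivity)).compSubConstCLM ℂ x

lemma heatKernel_apply {n : ℕ} {t : ℝ} (ht : 0 < t) (x y : Rn n) :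
    heatKernel ht x y =
      ((1 / Real.sqrt ((4 * Real.pi * t) ^ n) * Real.exp (-‖x - y‖ ^ 2 / (4 * t)) : ℝ) : ℂ) := by
  have h : -(1 / (4 * t)) * ‖y - x‖ ^ 2 = -‖x - y‖ ^ 2 / (4 * t) := by
    rw [norm_sub_rev]
    ring
  have h' : gaussian n (b := 1 / (4 * t)) (by positivity) (y - x) =
      ((Real.exp (-(1 / (4 * t)) * ‖y - x‖ ^ 2) : ℝ) : ℂ) := rfl
  rw [Complex.ofReal_mul, ← h, ← h']
  rfl

/-- The heat semigroup `e^{tΔ} f (x)` of a tempered distribution `f`, by duality. -/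
def heat {n : ℕ} {t : ℝ} (ht : 0 < t) (f : 𝓢'(Rn n, ℂ)) (x : Rn n) : ℂ :=
  f (heatKernel ht x)

/-- The maximal function `sup_{t > 0} |e^{tΔ} f (x)|`, with values in `[0, ∞]`. -/
def heatMax {n : ℕ} (f : 𝓢'(Rn n, ℂ)) (x : Rn n) : ℝ≥0∞ :=
  ⨆ (t : ℝ) (ht : 0 < t), ‖heat ht f x‖ₑ

/-- The norm of the generalized Hardy-Morrey space `Hℳ_{p,φ}(ℝⁿ)`. -/
def hardyMorreyNorm {n : ℕ} (p : ℝ≥0∞) (φ : Rn n → ℝ → ℝ) (f : 𝓢'(Rn n, ℂ)) : ℝ≥0∞ :=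
  morreyNorm p φ (heatMax f)

/-- Membership in the generalized Hardy-Morrey space `Hℳ_{p,φ}(ℝⁿ)`. -/
def MemHardyMorrey {n : ℕ} (p : ℝ≥0∞) (φ : Rn n → ℝ → ℝ) (f : 𝓢'(Rn n, ℂ)) : Prop :=
  MemMorrey p φ (heatMax f)

/-- The function `(∑_j (λ_j χ_{Q_j})^p)^(1/p)`, with values in `[0, ∞]`. -/
def cubeSum {n : ℕ} (p : ℝ) (lam : ℕ → ℝ) (Q : ℕ → Cube n) (x : Rn n) : ℝ≥0∞ :=
  (∑' j, ((Q j).toSet.indicator (fun _ => ENNReal.ofReal (lam j)) x) ^ p) ^ (1 / p)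

/-- The series `∑_j u_j` of (locally integrable) functions converges to `f` in `𝓢'(ℝⁿ)`: its
partial sums, as tempered distributions, tend to `f` when tested on any Schwartz function. -/
def SumsTo {n : ℕ} (u : ℕ → Rn n → ℂ) (f : 𝓢'(Rn n, ℂ)) : Prop :=
  ∀ κ : 𝓢(Rn n, ℂ),
    Tendsto (fun N => ∑ j ∈ Finset.range N, ∫ x, u j x * κ x) atTop (𝓝 (f κ))

end HardyMorrey

end

noncomputable section

namespace HardyMorrey

/-! ### Cubes -/

/-! Everything reduces to one pointwise estimate and one summation over cubes. Let `m` be the first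
integer above `d`, so that `p * (n + m) > n`. Pair an atom with a kernel centred at `x`. Near the
cube the pairing is at most the maximal function of the atom; when `x` lies at distance about `2 ^
k` sides, Taylor's formula and the vanishing moments give the decay `2 ^ (-k * (n + m))`. This is
`exists_pairing_rpow_le_majorant`, uniform in the scale of the kernel. Since `p ≤ 1`, the `p`-th
power of the series is at most `S = ∑ λ_j ^ p * majorant_j`.

It remains to bound the average of `S` over a cube `R` by `φ(R) ^ p`. The norm of `cubeSum` gives
only the packing condition `∑_{Q_j ⊆ R} λ_j ^ p |Q_j| ≤ N ^ p φ(R) ^ p |R|`. Cubes small compared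
with `R` are summed by packing in `3R`. A large cube contributes to `R` in proportion to `|R|` times
a power of an `η`-ratio; grouping large cubes by size and packing in dilates of `R` leaves a sum of
powers of `φ / η` along dyadic dilations, which the Dini condition makes geometric
(`dini_geometric_decay`, `exists_packing_sum_le`). The required local bound on the maximal function
of an atom is Kolmogorov's inequality, where `p < q` enters (`exists_lintegral_maximalFn_rpow_le`).
The far part is a sum over dilates of `Q_j`, each costing `2 ^ (k * n)` and gaining `2 ^ (-k * p *
(n + m))`.

The same estimate gives convergence: `S` is locally integrable, hence finite at some `x₀`, and every
Schwartz function is an admissible kernel at `x₀` of scale one, with constant controlled by a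
seminorm. So the series converges absolutely against every test function, to a continuous
functional. -/

/-- The closed cube with centre `c` and side `s`. -/
def cubeSet {n : ℕ} (c : Rn n) (s : ℝ) : Set (Rn n) := {y | ∀ i, |y i - c i| ≤ s / 2}

lemma cubeSet_eq_preimage {n : ℕ} (c : Rn n) {s : ℝ} (hs : 0 ≤ s) :
    cubeSet c s = WithLp.ofLp ⁻¹' Metric.closedBall (WithLp.ofLp c) (s / 2) := by
  ext y
  simp only [cubeSet, Set.mem_ofPred_eq, Set.mem_preimage, Metric.mem_closedBall]
  rw [dist_pi_le_iff (by positivity)]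
  simp [Real.dist_eq]

lemma isClosed_cubeSet {n : ℕ} (c : Rn n) (s : ℝ) : IsClosed (cubeSet c s) := by
  have : cubeSet c s = ⋂ i, {y : Rn n | |y i - c i| ≤ s / 2} := by
    ext y; simp [cubeSet]
  rw [this]
  exact isClosed_iInter fun i => isClosed_le (by fun_prop) continuous_const

lemma measurableSet_cubeSet {n : ℕ} (c : Rn n) (s : ℝ) : MeasurableSet (cubeSet c s) :=
  (isClosed_cubeSet c s).measurableSet

lemma volume_cubeSet {n : ℕ} (c : Rn n) {s : ℝ} (hs : 0 ≤ s) :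
    volume (cubeSet c s) = ENNReal.ofReal s ^ n := by
  rw [cubeSet_eq_preimage c hs,
    (PiLp.volume_preserving_ofLp (Fin n)).measure_preimage
      Metric.isClosed_closedBall.measurableSet.nullMeasurableSet,
    Real.volume_pi_closedBall _ (by positivity), ENNReal.ofReal_pow (by positivity)]
  simp [mul_div_cancel₀]

/-- If two cubes meet, then the smaller one lies in a controlled enlargement of the other. -/
lemma cubeSet_subset_of_inter {n : ℕ} {c c' : Rn n} {s s' r D : ℝ}
    (h : (cubeSet c s ∩ cubeSet c' D).Nonempty)
    (hs : s + D + s' ≤ r) : cubeSet c' s' ⊆ cubeSet c r := by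
  obtain ⟨z, hz, hz'⟩ := h
  intro y hy i
  have h1 := abs_le.1 (hz i)
  have h2 := abs_le.1 (hz' i)
  have h3 := abs_le.1 (hy i)
  rw [abs_le]
  constructor <;> linarith

lemma norm_sub_le_of_inter {n : ℕ} {c c' : Rn n} {s D : ℝ} (hs : 0 ≤ s) (hD : 0 ≤ D)
    (h : (cubeSet c s ∩ cubeSet c' D).Nonempty) : ‖(c' - c).ofLp‖ ≤ (s + D) / 2 := by
  obtain ⟨z, hz, hz'⟩ := h
  rw [pi_norm_le_iff_of_nonneg (by positivity)]
  intro i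
  have h1 := abs_le.1 (hz i)
  have h2 := abs_le.1 (hz' i)
  simp only [PiLp.sub_apply, Real.norm_eq_abs]
  rw [abs_le]
  constructor <;> linarith

/-! ### The class `𝒢₁` -/

lemma GClass.exists_growth {n : ℕ} {φ : Rn n → ℝ → ℝ} (h : GClass 1 φ) :
    ∃ C : ℝ, 0 < C ∧ ∀ (x y : Rn n) (s r : ℝ), 0 < s → 0 < r →
      ‖(x - y).ofLp‖ ≤ r - s → φ y s * s ^ n ≤ C * (φ x r * r ^ n) := by
  obtain ⟨C, hC⟩ := h.growth
  refine ⟨max C 1, by positivity, fun x y s r hs hr hxy => ?_⟩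
  have := hC x y s r hs hr hxy
  simp only [div_one, Real.rpow_natCast] at this
  have h2 := h.pos x r hr
  exact this.trans (by gcongr; exact le_max_left _ _)

/-- Growth for concentric cubes of sides `r` and `2 * r`. With monotonicity it keeps `φ x`
comparable to `φ x r` on `[r, 2 * r]`, so one dyadic piece of the Dini integral controls a point
value. -/
lemma GClass.exists_doubling {n : ℕ} {φ : Rn n → ℝ → ℝ} (h : GClass 1 φ) :
    ∃ C : ℝ, 0 < C ∧ ∀ (x : Rn n) (r : ℝ), 0 < r → φ x r ≤ C * φ x (2 * r) := by
  obtain ⟨C, hC, hg⟩ := h.exists_growth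
  refine ⟨C * 2 ^ n, by positivity, fun x r hr => ?_⟩
  have := hg x x r (2 * r) hr (by positivity) (by simp; linarith)
  have hrn : 0 < r ^ n := by positivity
  rw [mul_pow] at this
  refine le_of_mul_le_mul_right (this.trans (le_of_eq ?_)) hrn
  ring

/-- The Dini condition implies geometric decay of `φ / η` along dyadic dilations. -/
lemma dini_geometric_decay {n : ℕ} {φ η : Rn n → ℝ → ℝ} (hφ : GClass 1 φ) (hη : GClass 1 η)
    (hint : ∃ C : ℝ, ∀ (x : Rn n) (r : ℝ), 0 < r →
      ∫⁻ s in Set.Ioi r, ENNReal.ofReal (φ x s / (η x s * s)) ≤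
        ENNReal.ofReal (C * (φ x r / η x r))) :
    ∃ K θ : ℝ, 0 < K ∧ 0 ≤ θ ∧ θ < 1 ∧ ∀ (x : Rn n) (r : ℝ) (m : ℕ), 0 < r →
      φ x (2 ^ m * r) / η x (2 ^ m * r) ≤ K * θ ^ m * (φ x r / η x r) := by
  obtain ⟨C₀, hC₀⟩ := hint
  obtain ⟨C₁, hC₁, hd⟩ := hφ.exists_doubling
  set c : ℝ := 1 / (2 * C₁) with hc
  have hcpos : 0 < c := by positivity
  -- The second entry makes `C` positive and forces `c / C ≤ 1 / 2`, so that `1 - c / C` is a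
  -- legitimate ratio.
  set C : ℝ := max C₀ (2 * c) with hC
  have hCpos : 0 < C := lt_of_lt_of_le (by positivity) (le_max_right _ _)
  have ψpos : ∀ x r, 0 < r → 0 < φ x r / η x r := fun x r hr =>
    div_pos (hφ.pos x r hr) (hη.pos x r hr)
  -- The decay is proved for the tail integral and then transferred. With `ψ = φ / η`, the piece
  -- over `(r, 2r]` is at least `c * ψ r` and the whole tail is at most `C * ψ r`, so doubling `r`
  -- removes a fixed proportion of `J`. Finally `c * ψ ≤ J ≤ C * ψ` at the two ends.
  let J : Rn n → ℝ → ℝ≥0∞ := fun x r =>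
    ∫⁻ s in Set.Ioi r, ENNReal.ofReal (φ x s / (η x s * s))
  have hJ : ∀ x r, 0 < r → J x r ≤ ENNReal.ofReal (C * (φ x r / η x r)) := fun x r hr =>
    (hC₀ x r hr).trans (ENNReal.ofReal_le_ofReal (by
      have := ψpos x r hr
      gcongr
      exact le_max_left _ _))
  have hstep : ∀ x r, 0 < r → ENNReal.ofReal (c * (φ x r / η x r)) + J x (2 * r) ≤ J x r := by
    intro x r hr
    have hU : Set.Ioi r = Set.Ioc r (2 * r) ∪ Set.Ioi (2 * r) :=
      (Set.Ioc_union_Ioi_eq_Ioi (by linarith)).symm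
    have hJr : J x r = (∫⁻ s in Set.Ioc r (2 * r), ENNReal.ofReal (φ x s / (η x s * s))) +
        J x (2 * r) := by
      simp only [J]
      rw [hU, lintegral_union measurableSet_Ioi]
      exact Set.disjoint_left.2 fun y hy hy' => not_lt.2 hy.2 hy'
    rw [hJr]
    gcongr
    have hlow : ∀ s ∈ Set.Ioc r (2 * r), ENNReal.ofReal (c * (φ x r / η x r) / r) ≤
        ENNReal.ofReal (φ x s / (η x s * s)) := by
      intro s hs
      have hs0 : 0 < s := hr.trans hs.1
      apply ENNReal.ofReal_le_ofReal
      have h1 : φ x r / C₁ ≤ φ x s := by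
        rw [div_le_iff₀' hC₁]
        refine (hd x r hr).trans ?_
        gcongr
        exact hφ.anti x s (2 * r) hs0 hs.2
      have h2 : η x s ≤ η x r := hη.anti x r s hr hs.1.le
      have h3 := hη.pos x s hs0
      have h4 := hφ.pos x r hr
      have h5 := hη.pos x r hr
      calc c * (φ x r / η x r) / r = (φ x r / C₁) / (η x r * (2 * r)) := by
            rw [hc]; field_simp
        _ ≤ φ x s / (η x s * s) := by
            gcongr
            · exact (hφ.pos x s hs0).le
            · exact hs.2
    calc ENNReal.ofReal (c * (φ x r / η x r))
        = ∫⁻ s in Set.Ioc r (2 * r), ENNReal.ofReal (c * (φ x r / η x r) / r) := by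
          rw [lintegral_const, Measure.restrict_apply_univ, Real.volume_Ioc,
            ← ENNReal.ofReal_mul (by have := ψpos x r hr; positivity)]
          congr 1
          field_simp
          ring
      _ ≤ _ := setLIntegral_mono' measurableSet_Ioc hlow
  have hfin : ∀ x r, 0 < r → J x r ≠ ∞ := fun x r hr =>
    ne_top_of_le_ne_top ENNReal.ofReal_ne_top (hJ x r hr)
  have hJ' : ∀ x r, 0 < r → (J x r).toReal ≤ C * (φ x r / η x r) := fun x r hr =>
    ENNReal.toReal_le_of_le_ofReal (by have := ψpos x r hr; positivity) (hJ x r hr)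
  have hstep' : ∀ x r, 0 < r → c * (φ x r / η x r) + (J x (2 * r)).toReal ≤ (J x r).toReal := by
    intro x r hr
    have := ENNReal.toReal_mono (hfin x r hr) (hstep x r hr)
    rwa [ENNReal.toReal_add ENNReal.ofReal_ne_top (hfin x _ (by positivity)),
      ENNReal.toReal_ofReal (by have := ψpos x r hr; positivity)] at this
  have hcC : c / C < 1 := by
    rw [div_lt_one hCpos]
    exact lt_of_lt_of_le (by linarith) (le_max_right _ _)
  have hθ0 : 0 ≤ 1 - c / C := by linarith
  have hdec : ∀ x r, 0 < r → (J x (2 * r)).toReal ≤ (1 - c / C) * (J x r).toReal := by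
    intro x r hr
    have h1 : (J x r).toReal / C ≤ φ x r / η x r := by
      rw [div_le_iff₀' hCpos]; exact hJ' x r hr
    have h2 := hstep' x r hr
    have h3 : c * ((J x r).toReal / C) ≤ c * (φ x r / η x r) := by gcongr
    have h4 : c * ((J x r).toReal / C) = c / C * (J x r).toReal := by ring
    linarith
  refine ⟨C / c, 1 - c / C, by positivity, hθ0, by have : 0 < c / C := by positivity
                                                   linarith, ?_⟩
  intro x r m hr
  have hpow : (J x (2 ^ m * r)).toReal ≤ (1 - c / C) ^ m * (J x r).toReal := by
    induction m with
    | zero => simp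
    | succ m ih =>
      have h1 := hdec x (2 ^ m * r) (by positivity)
      rw [pow_succ', mul_assoc, pow_succ', mul_assoc]
      exact h1.trans (by gcongr)
  have h1 : c * (φ x (2 ^ m * r) / η x (2 ^ m * r)) ≤ (J x (2 ^ m * r)).toReal :=
    le_trans (le_add_of_nonneg_right ENNReal.toReal_nonneg) (hstep' x _ (by positivity))
  have h2 := hJ' x r hr
  have h3 : c * (φ x (2 ^ m * r) / η x (2 ^ m * r)) ≤
      (1 - c / C) ^ m * (C * (φ x r / η x r)) :=
    h1.trans (hpow.trans (by gcongr))
  rw [← le_div_iff₀' hcpos] at h3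
  exact h3.trans (le_of_eq (by ring))

/-! ### Summation over families of cubes -/

open Classical in
/-- The packing condition `∑_{Q_j ⊆ R} L_j |Q_j| ≤ A φ(R)^p |R|` for all cubes `R`. -/
def Packing {n : ℕ} (p : ℝ) (φ : Rn n → ℝ → ℝ) (Q : ℕ → Cube n) (L : ℕ → ℝ≥0∞) (A : ℝ≥0∞) : Prop :=
  ∀ (c : Rn n) (s : ℝ), 0 < s →
    ∑' j, (if (Q j).toSet ⊆ cubeSet c s then L j * ENNReal.ofReal (Q j).side ^ n else 0) ≤
      A * ENNReal.ofReal (φ c s) ^ p * ENNReal.ofReal s ^ n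

-- The functions `h j` live on the dilates `D Q_j`; both the near part of the majorants and each
-- dilate indicator have this form. Dilates smaller than the test cube use only the total mass `B₁`,
-- larger ones the local bound `B₂`. The loss `D ^ n` must be explicit, because it is later summed
-- over `D = 2 * n * 2 ^ (k + 1)`.
open Classical in
lemma exists_packing_sum_le {n : ℕ} {p : ℝ} (hp0 : 0 < p) {φ η : Rn n → ℝ → ℝ}
    (hφ : GClass 1 φ) (hη : GClass 1 η)
    (hint : ∃ C : ℝ, ∀ (x : Rn n) (r : ℝ), 0 < r →
      ∫⁻ s in Set.Ioi r, ENNReal.ofReal (φ x s / (η x s * s)) ≤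
        ENNReal.ofReal (C * (φ x r / η x r))) :
    ∃ K : ℝ≥0∞, K ≠ ∞ ∧ ∀ (Q : ℕ → Cube n) (L : ℕ → ℝ≥0∞) (A : ℝ≥0∞), Packing p φ Q L A →
      ∀ (D : ℝ) (B₁ B₂ : ℝ≥0∞) (h : ℕ → Rn n → ℝ≥0∞), 1 ≤ D →
      (∀ j x, x ∉ cubeSet (Q j).center (D * (Q j).side) → h j x = 0) →
      (∀ j, ∫⁻ x, h j x ≤ B₁ * ENNReal.ofReal (Q j).side ^ n) →
      (∀ j c s, 0 < s → s ≤ D * (Q j).side →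
        (cubeSet c s ∩ cubeSet (Q j).center (D * (Q j).side)).Nonempty →
        ∫⁻ x in cubeSet c s, h j x ≤
          B₂ * ENNReal.ofReal s ^ n * ENNReal.ofReal (η c s / η c (D * (Q j).side)) ^ p) →
      ∀ c s, 0 < s → ∑' j, L j * ∫⁻ x in cubeSet c s, h j x ≤
        K * (B₁ + B₂ * ENNReal.ofReal D ^ n) *
          (A * ENNReal.ofReal (φ c s) ^ p * ENNReal.ofReal s ^ n) := by
  obtain ⟨K, θ, hK, hθ0, hθ1, hdec⟩ := dini_geometric_decay hφ hη hint
  have hθp : ENNReal.ofReal θ ^ p < 1 :=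
    ENNReal.rpow_lt_one (by
      rw [← ENNReal.ofReal_one]
      exact (ENNReal.ofReal_lt_ofReal_iff one_pos).2 hθ1) hp0
  refine ⟨3 ^ n + 8 ^ n * ENNReal.ofReal K ^ p * (1 - ENNReal.ofReal θ ^ p)⁻¹, ?_, ?_⟩
  · refine ENNReal.add_ne_top.2 ⟨by finiteness, ENNReal.mul_ne_top (ENNReal.mul_ne_top (by finiteness)
      (ENNReal.rpow_ne_top_of_nonneg hp0.le ENNReal.ofReal_ne_top)) ?_⟩
    rw [ENNReal.inv_ne_top]
    exact (tsub_pos_of_lt hθp).ne'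
  intro Q L A hpack D B₁ B₂ h hD hsupp hh hloc c s hs
  have hD0 : 0 < D := by linarith
  set T : ℝ → ℕ → ℝ≥0∞ := fun r j =>
    if (Q j).toSet ⊆ cubeSet c r then L j * ENNReal.ofReal (Q j).side ^ n else 0 with hT
  have hptw : ∀ j, L j * ∫⁻ x in cubeSet c s, h j x ≤ B₁ * T (3 * s) j +
      ∑' m : ℕ, B₂ * ENNReal.ofReal s ^ n * ENNReal.ofReal (η c s / η c (2 ^ (m + 1) * s)) ^ p *
        ENNReal.ofReal (D / (2 ^ m * s)) ^ n * T (2 ^ (m + 3) * s) j := by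
    intro j
    have hl := (Q j).side_pos
    set ℓ := (Q j).side with hℓ
    by_cases hmeet : (cubeSet c s ∩ cubeSet (Q j).center (D * ℓ)).Nonempty
    swap
    · have : ∫⁻ x in cubeSet c s, h j x = 0 := by
        rw [setLIntegral_congr_fun (g := fun _ => 0) (measurableSet_cubeSet c s)
          (fun x hx => hsupp j x fun hx' => hmeet ⟨x, hx, hx'⟩)]
        simp
      rw [this, mul_zero]
      exact zero_le
    have hℓD : ℓ ≤ D * ℓ := le_mul_of_one_le_left hl.le hD
    rcases lt_or_ge (D * ℓ) s with hsmall | hlarge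
    · have hsub : (Q j).toSet ⊆ cubeSet c (3 * s) :=
        cubeSet_subset_of_inter hmeet (s' := ℓ) (by linarith)
      refine le_trans ?_ le_self_add
      simp only [hT, if_pos hsub]
      calc L j * ∫⁻ x in cubeSet c s, h j x ≤ L j * (B₁ * ENNReal.ofReal ℓ ^ n) := by
            gcongr
            exact (setLIntegral_le_lintegral _ _).trans (hh j)
        _ = _ := by ring
    -- The dilate has side in `[2 ^ m * s, 2 ^ (m + 1) * s)` and meets the test cube, so `Q j` lies
    -- in the concentric cube of side `8 * 2 ^ m * s`.
    · obtain ⟨m, hm1, hm2⟩ := exists_nat_pow_near (x := D * ℓ / s) (y := 2)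
        (by rwa [le_div_iff₀ hs, one_mul]) (by norm_num)
      rw [le_div_iff₀ hs] at hm1
      rw [div_lt_iff₀ hs] at hm2
      have h2m : (1 : ℝ) ≤ 2 ^ m := one_le_pow₀ (by norm_num)
      have hsm : s ≤ 2 ^ m * s := le_mul_of_one_le_left hs.le h2m
      have hsub : (Q j).toSet ⊆ cubeSet c (2 ^ (m + 3) * s) :=
        cubeSet_subset_of_inter hmeet (s' := ℓ) (by rw [pow_succ] at hm2; rw [pow_add]; linarith)
      refine le_trans ?_ le_add_self
      refine le_trans ?_ (ENNReal.le_tsum m)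
      simp only [hT, if_pos hsub]
      have h1 : ENNReal.ofReal (η c s / η c (D * ℓ)) ≤
          ENNReal.ofReal (η c s / η c (2 ^ (m + 1) * s)) := by
        apply ENNReal.ofReal_le_ofReal
        have := hη.pos c s hs
        have := hη.pos c (2 ^ (m + 1) * s) (by positivity)
        gcongr
        exact hη.anti c _ _ (by positivity) hm2.le
      -- This factor brings in the volume of `Q j`, which the packing condition needs.
      have h2 : (1 : ℝ≥0∞) ≤ ENNReal.ofReal (D / (2 ^ m * s)) ^ n * ENNReal.ofReal ℓ ^ n := by
        rw [← mul_pow, ← ENNReal.ofReal_mul (by positivity)]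
        apply one_le_pow₀
        rw [← ENNReal.ofReal_one]
        apply ENNReal.ofReal_le_ofReal
        rw [div_mul_eq_mul_div, le_div_iff₀ (by positivity), one_mul]
        exact hm1
      calc L j * ∫⁻ x in cubeSet c s, h j x
          ≤ L j * (B₂ * ENNReal.ofReal s ^ n * ENNReal.ofReal (η c s / η c (2 ^ (m + 1) * s)) ^ p) := by
            gcongr
            exact (hloc j c s hs hlarge hmeet).trans (by gcongr)
        _ ≤ L j * (B₂ * ENNReal.ofReal s ^ n * ENNReal.ofReal (η c s / η c (2 ^ (m + 1) * s)) ^ p) *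
            (ENNReal.ofReal (D / (2 ^ m * s)) ^ n * ENNReal.ofReal ℓ ^ n) := le_mul_of_one_le_right' h2
        _ = _ := by ring
  calc ∑' j, L j * ∫⁻ x in cubeSet c s, h j x
      ≤ ∑' j, (B₁ * T (3 * s) j + ∑' m : ℕ, B₂ * ENNReal.ofReal s ^ n *
          ENNReal.ofReal (η c s / η c (2 ^ (m + 1) * s)) ^ p *
          ENNReal.ofReal (D / (2 ^ m * s)) ^ n * T (2 ^ (m + 3) * s) j) := ENNReal.tsum_le_tsum hptw
    _ = B₁ * ∑' j, T (3 * s) j + ∑' m : ℕ, B₂ * ENNReal.ofReal s ^ n *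
          ENNReal.ofReal (η c s / η c (2 ^ (m + 1) * s)) ^ p *
          ENNReal.ofReal (D / (2 ^ m * s)) ^ n * ∑' j, T (2 ^ (m + 3) * s) j := by
        rw [ENNReal.tsum_add, ENNReal.tsum_mul_left, ENNReal.tsum_comm]
        simp_rw [ENNReal.tsum_mul_left]
    _ ≤ B₁ * (3 ^ n * (A * ENNReal.ofReal (φ c s) ^ p * ENNReal.ofReal s ^ n)) +
          ∑' m : ℕ, (B₂ * ENNReal.ofReal D ^ n * 8 ^ n * ENNReal.ofReal K ^ p *
            (A * ENNReal.ofReal (φ c s) ^ p * ENNReal.ofReal s ^ n)) * (ENNReal.ofReal θ ^ p) ^ m := by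
        refine add_le_add (mul_le_mul_right ?_ _) (ENNReal.tsum_le_tsum fun m => ?_)
        · refine (hpack c (3 * s) (by positivity)).trans ?_
          rw [ENNReal.ofReal_mul (by norm_num), mul_pow]
          calc _ ≤ A * ENNReal.ofReal (φ c s) ^ p *
                (ENNReal.ofReal 3 ^ n * ENNReal.ofReal s ^ n) := by
                gcongr; exact hφ.anti c s _ hs (by linarith)
            _ = _ := by norm_num; ring
        -- Packing is applied at side `2 ^ (m + 3) * s`, but `φ` is then read at the smaller side
        -- `r`, where it is larger, to pair with `η c r`.
        · set r : ℝ := 2 ^ (m + 1) * s with hr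
          have hr0 : 0 < r := by positivity
          have hrr : r ≤ 2 ^ (m + 3) * s := by
            rw [hr]; gcongr <;> norm_num
          have hηr := hη.pos c r hr0
          have hηs := hη.pos c s hs
          have hφpos := hφ.pos c s hs
          have hkey : ENNReal.ofReal (η c s / η c r) ^ p * ENNReal.ofReal (φ c r) ^ p ≤
              ENNReal.ofReal K ^ p * (ENNReal.ofReal θ ^ p) ^ m * ENNReal.ofReal (φ c s) ^ p := by
            rw [← ENNReal.rpow_mul_natCast, mul_comm p, ENNReal.rpow_mul,
              ENNReal.rpow_natCast, ← ENNReal.mul_rpow_of_nonneg _ _ hp0.le,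
              ← ENNReal.mul_rpow_of_nonneg _ _ hp0.le, ← ENNReal.mul_rpow_of_nonneg _ _ hp0.le,
              ← ENNReal.ofReal_pow hθ0, ← ENNReal.ofReal_mul (by positivity),
              ← ENNReal.ofReal_mul (by positivity), ← ENNReal.ofReal_mul (by positivity)]
            refine ENNReal.rpow_le_rpow (ENNReal.ofReal_le_ofReal ?_) hp0.le
            have := hdec c s (m + 1) hs
            rw [← hr] at this
            calc η c s / η c r * φ c r = η c s * (φ c r / η c r) := by ring
              _ ≤ η c s * (K * θ ^ (m + 1) * (φ c s / η c s)) := by gcongr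
              _ = K * θ ^ (m + 1) * φ c s := by field_simp
              _ ≤ K * θ ^ m * φ c s := by
                gcongr K * ?_ * _
                exact pow_le_pow_of_le_one hθ0 hθ1.le (by omega)
          have hgeom : ENNReal.ofReal (D / (2 ^ m * s)) ^ n * ENNReal.ofReal (2 ^ (m + 3) * s) ^ n =
              ENNReal.ofReal D ^ n * 8 ^ n := by
            rw [← mul_pow, ← mul_pow, ← ENNReal.ofReal_mul (by positivity)]
            congr 1
            rw [show (8 : ℝ≥0∞) = ENNReal.ofReal 8 by norm_num, ← ENNReal.ofReal_mul (by positivity)]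
            congr 1
            rw [pow_add]
            field_simp
            norm_num
          calc _ ≤ B₂ * ENNReal.ofReal s ^ n * ENNReal.ofReal (η c s / η c r) ^ p *
                ENNReal.ofReal (D / (2 ^ m * s)) ^ n * (A * ENNReal.ofReal (φ c r) ^ p *
                  ENNReal.ofReal (2 ^ (m + 3) * s) ^ n) := by
                gcongr
                refine (hpack c _ (by positivity)).trans ?_
                gcongr
                exact hφ.anti c r _ hr0 hrr
            _ = B₂ * ENNReal.ofReal s ^ n * A *
                (ENNReal.ofReal (D / (2 ^ m * s)) ^ n * ENNReal.ofReal (2 ^ (m + 3) * s) ^ n) *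
                (ENNReal.ofReal (η c s / η c r) ^ p * ENNReal.ofReal (φ c r) ^ p) := by ring
            _ ≤ B₂ * ENNReal.ofReal s ^ n * A * (ENNReal.ofReal D ^ n * 8 ^ n) *
                (ENNReal.ofReal K ^ p * (ENNReal.ofReal θ ^ p) ^ m * ENNReal.ofReal (φ c s) ^ p) := by
                rw [hgeom]; gcongr
            _ = _ := by ring
    _ ≤ _ := by
        rw [ENNReal.tsum_mul_left, ENNReal.tsum_geometric]
        set X := A * ENNReal.ofReal (φ c s) ^ p * ENNReal.ofReal s ^ n
        set G := (1 - ENNReal.ofReal θ ^ p)⁻¹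
        calc _ = (3 ^ n * B₁ + 8 ^ n * ENNReal.ofReal K ^ p * G *
              (B₂ * ENNReal.ofReal D ^ n)) * X := by ring
          _ ≤ _ := by
            gcongr
            rw [add_mul, mul_add, mul_add]
            gcongr
            · exact le_self_add
            · exact le_add_self

/-! ### The Hardy–Littlewood maximal function -/

/-- The uncentred Hardy–Littlewood maximal function over Euclidean balls. -/
def maximalFn {n : ℕ} (g : Rn n → ℝ≥0∞) (x : Rn n) : ℝ≥0∞ :=
  ⨆ (c : Rn n) (r : ℝ) (_ : 0 < r), (Metric.ball c r).indicator
    (fun _ => (∫⁻ y in Metric.ball c r, g y) / volume (Metric.ball c r)) x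

lemma average_le_maximalFn {n : ℕ} (g : Rn n → ℝ≥0∞) {x c : Rn n} {r : ℝ}
    (hx : x ∈ Metric.ball c r) :
    (∫⁻ y in Metric.ball c r, g y) / volume (Metric.ball c r) ≤ maximalFn g x := by
  have hr : 0 < r := dist_nonneg.trans_lt hx
  refine le_trans ?_ (le_iSup_of_le c (le_iSup_of_le r (le_iSup_of_le hr le_rfl)))
  rw [Set.indicator_of_mem hx]

lemma lintegral_ball_le_maximalFn {n : ℕ} (g : Rn n → ℝ≥0∞) {x c : Rn n} {r : ℝ}
    (hx : x ∈ Metric.ball c r) :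
    ∫⁻ y in Metric.ball c r, g y ≤ maximalFn g x * volume (Metric.ball c r) := by
  have hr : 0 < r := dist_nonneg.trans_lt hx
  have := average_le_maximalFn g hx
  rwa [ENNReal.div_le_iff (Metric.measure_ball_pos _ _ hr).ne' measure_ball_lt_top.ne] at this

lemma maximalFn_le {n : ℕ} {g : Rn n → ℝ≥0∞} {x : Rn n} {b : ℝ≥0∞}
    (h : ∀ c r, x ∈ Metric.ball c r →
      (∫⁻ y in Metric.ball c r, g y) / volume (Metric.ball c r) ≤ b) : maximalFn g x ≤ b := by
  refine iSup_le fun c => iSup_le fun r => iSup_le fun _ => ?_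
  by_cases hx : x ∈ Metric.ball c r
  · rw [Set.indicator_of_mem hx]; exact h c r hx
  · rw [Set.indicator_of_notMem hx]; exact zero_le

lemma measurable_maximalFn {n : ℕ} (g : Rn n → ℝ≥0∞) : Measurable (maximalFn g) := by
  refine LowerSemicontinuous.measurable ?_
  exact lowerSemicontinuous_iSup fun c => lowerSemicontinuous_iSup fun r =>
    lowerSemicontinuous_iSup fun _ => Metric.isOpen_ball.lowerSemicontinuous_indicator zero_le

lemma volume_ball_eq {n : ℕ} (c : Rn n) {r : ℝ} (hr : 0 < r) :
    volume (Metric.ball c r) = ENNReal.ofReal r ^ n * volume (Metric.ball (0 : Rn n) 1) := by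
  rw [Measure.addHaar_ball_of_pos _ c hr, finrank_euclideanSpace_fin,
    ENNReal.ofReal_pow hr.le]

/-- The weak type `(1,1)` inequality for the maximal function. -/
lemma mul_volume_maximalFn_le {n : ℕ} (hn : 0 < n) (g : Rn n → ℝ≥0∞) {t : ℝ≥0∞} (ht0 : t ≠ 0)
    (ht : t ≠ ∞) : t * volume {x | t < maximalFn g x} ≤ 4 ^ n * ∫⁻ x, g x := by
  rcases eq_or_ne (∫⁻ x, g x) ∞ with hI | hI
  · rw [hI, ENNReal.mul_top (by positivity)]; exact le_top
  set v := volume (Metric.ball (0 : Rn n) 1) with hv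
  have hv0 : v ≠ 0 := (Metric.measure_ball_pos _ _ one_pos).ne'
  have hvt : v ≠ ∞ := measure_ball_lt_top.ne
  -- The balls with average at least `t`. Vitali's lemma needs bounded radii: since `∫ g` is finite,
  -- so is the volume of such a ball, and `r ≤ r ^ n` for `r ≥ 1` bounds the radius. Any enlargement
  -- factor above `3` works; `4` gives the constant `4 ^ n`.
  let F : Set (Rn n × ℝ) := {b | 0 < b.2 ∧
    t * volume (Metric.ball b.1 b.2) ≤ ∫⁻ y in Metric.ball b.1 b.2, g y}
  set Z : ℝ≥0∞ := (∫⁻ x, g x) / (t * v) with hZ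
  have hZt : Z ≠ ∞ := ENNReal.div_ne_top hI (mul_ne_zero ht0 hv0)
  have hR : ∀ b ∈ F, b.2 ≤ max 1 Z.toReal := by
    rintro b ⟨hb, hb'⟩
    rcases le_total b.2 1 with h1 | h1
    · exact h1.trans (le_max_left _ _)
    refine le_trans ?_ (le_max_right _ _)
    have h2 : ENNReal.ofReal (b.2 ^ n) ≤ Z := by
      rw [hZ, ENNReal.le_div_iff_mul_le (Or.inl (mul_ne_zero ht0 hv0))
        (Or.inl (ENNReal.mul_ne_top ht hvt)), ENNReal.ofReal_pow hb.le]
      calc ENNReal.ofReal b.2 ^ n * (t * v) = t * volume (Metric.ball b.1 b.2) := by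
            rw [volume_ball_eq b.1 hb]; ring
        _ ≤ _ := hb'.trans (setLIntegral_le_lintegral _ _)
    have h3 := (ENNReal.ofReal_le_iff_le_toReal hZt).1 h2
    exact (le_self_pow₀ h1 hn.ne').trans h3
  obtain ⟨u, huF, hdisj, hcov⟩ := Vitali.exists_disjoint_subfamily_covering_enlargement_closedBall
    F (fun b => b.1) (fun b => b.2) _ hR 4 (by norm_num)
  have hcount : u.Countable := hdisj.countable_of_nonempty_interior fun b hb =>
    ⟨b.1, Metric.ball_subset_interior_closedBall (Metric.mem_ball_self (huF hb).1)⟩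
  have hsub : {x | t < maximalFn g x} ⊆ ⋃ b ∈ u, Metric.closedBall b.1 (4 * b.2) := by
    intro x hx
    by_contra hx'
    refine not_le.2 hx (maximalFn_le fun c r hxc => ?_)
    by_contra hlt
    have hr : 0 < r := dist_nonneg.trans_lt hxc
    have hmem : (c, r) ∈ F := by
      refine ⟨hr, ?_⟩
      have := (not_le.1 hlt).le
      rwa [ENNReal.le_div_iff_mul_le (Or.inl (Metric.measure_ball_pos _ _ hr).ne')
        (Or.inl measure_ball_lt_top.ne)] at this
    obtain ⟨b, hb, hb'⟩ := hcov _ hmem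
    exact hx' (Set.mem_biUnion hb (hb' (Metric.ball_subset_closedBall hxc)))
  have hdisj' : u.PairwiseDisjoint fun b => Metric.ball b.1 b.2 :=
    hdisj.mono fun b => Metric.ball_subset_closedBall
  have := hcount.to_subtype
  have : Nontrivial (Rn n) := Module.nontrivial_of_finrank_pos (R := ℝ)
    (by rwa [finrank_euclideanSpace_fin])
  calc t * volume {x | t < maximalFn g x}
      ≤ t * ∑' b : u, volume (Metric.closedBall b.1.1 (4 * b.1.2)) := by
        gcongr
        exact (measure_mono hsub).trans (measure_biUnion_le _ hcount _)
    _ = 4 ^ n * ∑' b : u, t * volume (Metric.ball b.1.1 b.1.2) := by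
        rw [← ENNReal.tsum_mul_left, ← ENNReal.tsum_mul_left]
        congr 1
        ext b
        rw [Measure.addHaar_closedBall_mul_of_pos _ _ (by norm_num),
          finrank_euclideanSpace_fin, Measure.addHaar_closedBall_eq_addHaar_ball,
          Measure.addHaar_ball_center, ← Measure.addHaar_ball_center _ b.1.1,
          ENNReal.ofReal_pow (by norm_num)]
        norm_num
        ring
    _ ≤ 4 ^ n * ∑' b : u, ∫⁻ y in Metric.ball b.1.1 b.1.2, g y := by
        gcongr with b
        exact (huF b.2).2
    _ = 4 ^ n * ∫⁻ y in ⋃ b ∈ u, Metric.ball b.1 b.2, g y := by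
        rw [lintegral_biUnion hcount (fun _ _ => measurableSet_ball) hdisj']
    _ ≤ 4 ^ n * ∫⁻ y, g y := by
        gcongr
        exact Measure.restrict_le_self

/-- Kolmogorov's inequality: a weak `L¹` bound on `E` controls the integral of `h ^ s`, `s < 1`. -/
lemma exists_kolmogorov_bound {s : ℝ} (hs0 : 0 < s) (hs1 : s < 1) {W : ℝ≥0∞} (hW : W ≠ ∞) :
    ∃ K : ℝ≥0∞, K ≠ ∞ ∧ ∀ {α : Type} [MeasurableSpace α] (μ : Measure α) (E : Set α)
      (h : α → ℝ≥0∞) (T : ℝ≥0∞), Measurable h → T ≠ 0 → T ≠ ∞ →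
      (∀ t : ℝ≥0∞, t ≠ 0 → t ≠ ∞ → t * μ.restrict E {x | t < h x} ≤ W * μ E * T) →
      ∫⁻ x in E, h x ^ s ∂μ ≤ K * μ E * T ^ s := by
  -- From one dyadic level to the next, the height to the power `s` gains `2 ^ s` and the weak bound
  -- loses `1 / 2`; `s < 1` makes the product less than one.
  set θ : ℝ≥0∞ := 2 ^ s * 2⁻¹ with hθ
  have hθ1 : θ < 1 := by
    have : θ = 2 ^ (s - 1) := by
      rw [hθ, ENNReal.rpow_sub _ _ (by norm_num) (by norm_num), ENNReal.rpow_one,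
        ENNReal.div_eq_inv_mul, mul_comm]
    rw [this]
    exact ENNReal.rpow_lt_one_of_one_lt_of_neg (by norm_num) (by linarith)
  have h2s : (2 : ℝ≥0∞) ^ s ≠ ∞ := ENNReal.rpow_ne_top_of_nonneg hs0.le (by norm_num)
  refine ⟨1 + 2 ^ s * (2 * W) * (1 - θ)⁻¹, ?_, ?_⟩
  · refine ENNReal.add_ne_top.2 ⟨by norm_num, ENNReal.mul_ne_top (ENNReal.mul_ne_top h2s
      (ENNReal.mul_ne_top (by norm_num) hW)) ?_⟩
    rw [ENNReal.inv_ne_top]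
    exact (tsub_pos_of_lt hθ1).ne'
  intro α _ μ E h T hh hT0 hT hweak
  have hTs : T ^ s ≠ 0 := (ENNReal.rpow_pos (pos_iff_ne_zero.2 hT0) hT).ne'
  -- The halving turns `2 ^ k * T ≤ h x` into the strict inequality of the weak-type hypothesis.
  let S : ℕ → Set α := fun k => {x | 2 ^ k * T / 2 < h x}
  have hS : ∀ k, MeasurableSet (S k) := fun k => measurableSet_lt measurable_const hh
  have hptw : ∀ x, h x ^ s ≤ T ^ s + ∑' k : ℕ,
      (S k).indicator (fun _ => (2 ^ (k + 1) * T) ^ s) x := by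
    intro x
    rcases le_or_gt (h x) T with hx | hx
    · exact (ENNReal.rpow_le_rpow hx hs0.le).trans le_self_add
    refine le_trans ?_ le_add_self
    -- At an infinite value every level set contains `x`, and the right side is infinite too.
    rcases eq_or_ne (h x) ∞ with hxt | hxt
    · have hall : ∀ k : ℕ, T ^ s ≤ (S k).indicator (fun _ => (2 ^ (k + 1) * T) ^ s) x := by
        intro k
        rw [Set.indicator_of_mem]
        · refine ENNReal.rpow_le_rpow ?_ hs0.le
          exact le_mul_of_one_le_left' (one_le_pow₀ (by norm_num))
        · simp only [S, Set.mem_ofPred_eq, hxt]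
          exact (ENNReal.div_lt_top (by finiteness) (by norm_num))
      have : ∑' _ : ℕ, T ^ s = ∞ := ENNReal.tsum_const_eq_top_of_ne_zero hTs
      exact le_top.trans (this.ge.trans (ENNReal.tsum_le_tsum hall))
    · have hT' : 0 < T.toReal := ENNReal.toReal_pos hT0 hT
      have hlt : T.toReal < (h x).toReal := (ENNReal.toReal_lt_toReal hT hxt).2 hx
      obtain ⟨k, hk1, hk2⟩ := exists_nat_pow_near (x := (h x).toReal / T.toReal) (y := 2)
        (by rw [le_div_iff₀ hT']; linarith) (by norm_num)
      rw [le_div_iff₀ hT'] at hk1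
      rw [div_lt_iff₀ hT'] at hk2
      have e1 : 2 ^ k * T ≤ h x := by
        rw [← ENNReal.toReal_le_toReal (by finiteness) hxt]
        simpa using hk1
      have e2 : h x ≤ 2 ^ (k + 1) * T := by
        rw [← ENNReal.toReal_le_toReal hxt (by finiteness)]
        simpa using hk2.le
      have e3 : x ∈ S k := by
        refine lt_of_lt_of_le (ENNReal.half_lt_self ?_ (by finiteness)) e1
        exact mul_ne_zero (by positivity) hT0
      calc h x ^ s ≤ (2 ^ (k + 1) * T) ^ s := ENNReal.rpow_le_rpow e2 hs0.le
        _ = (S k).indicator (fun _ => (2 ^ (k + 1) * T) ^ s) x := by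
          rw [Set.indicator_of_mem e3]
        _ ≤ _ := ENNReal.le_tsum k
  have hterm : ∀ k : ℕ, (2 ^ (k + 1) * T) ^ s * μ.restrict E (S k) ≤
      2 ^ s * (2 * W) * μ E * T ^ s * θ ^ k := by
    intro k
    have h1 := hweak (2 ^ k * T / 2) (by
      simp only [ne_eq, ENNReal.div_eq_zero_iff, mul_eq_zero, hT0, or_false, ENNReal.ofNat_ne_top]
      positivity) (ENNReal.div_ne_top (by finiteness) (by norm_num))
    have h2 : μ.restrict E (S k) ≤ (2⁻¹) ^ k * (2 * W * μ E) := by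
      have e : T * (2⁻¹ * (2 ^ k * μ.restrict E (S k))) ≤ T * (W * μ E) := by
        calc _ = 2 ^ k * T / 2 * μ.restrict E (S k) := by rw [ENNReal.div_eq_inv_mul]; ring
          _ ≤ W * μ E * T := h1
          _ = _ := by ring
      rw [ENNReal.mul_le_mul_iff_right hT0 hT] at e
      calc μ.restrict E (S k) = ((2⁻¹) ^ k * 2 ^ k) * (2 * 2⁻¹) * μ.restrict E (S k) := by
            rw [← mul_pow, ENNReal.inv_mul_cancel (by norm_num) (by norm_num),
              ENNReal.mul_inv_cancel (by norm_num) (by norm_num)]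
            simp
        _ = (2⁻¹) ^ k * 2 * (2⁻¹ * (2 ^ k * μ.restrict E (S k))) := by ring
        _ ≤ (2⁻¹) ^ k * 2 * (W * μ E) := by gcongr
        _ = _ := by ring
    calc (2 ^ (k + 1) * T) ^ s * μ.restrict E (S k)
        ≤ (2 ^ (k + 1) * T) ^ s * ((2⁻¹) ^ k * (2 * W * μ E)) := by gcongr
      _ = _ := by
        rw [ENNReal.mul_rpow_of_nonneg _ _ hs0.le, ← ENNReal.rpow_natCast, ← ENNReal.rpow_mul,
          mul_comm _ s, ENNReal.rpow_mul, ENNReal.rpow_natCast, hθ, mul_pow, pow_succ]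
        ring
  calc ∫⁻ x in E, h x ^ s ∂μ
      ≤ ∫⁻ x in E, (T ^ s + ∑' k : ℕ, (S k).indicator (fun _ => (2 ^ (k + 1) * T) ^ s) x) ∂μ :=
        lintegral_mono hptw
    _ = T ^ s * μ E + ∑' k : ℕ, (2 ^ (k + 1) * T) ^ s * μ.restrict E (S k) := by
        rw [lintegral_add_left measurable_const, lintegral_const, Measure.restrict_apply_univ,
          lintegral_tsum fun k => (measurable_const.indicator (hS k)).aemeasurable]
        simp_rw [lintegral_indicator_const (hS _)]
    _ ≤ T ^ s * μ E + ∑' k : ℕ, 2 ^ s * (2 * W) * μ E * T ^ s * θ ^ k := by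
        exact add_le_add le_rfl (ENNReal.tsum_le_tsum hterm)
    _ = _ := by
        rw [ENNReal.tsum_mul_left, ENNReal.tsum_geometric]
        ring

/-! ### Averages and the Morrey norm -/

lemma isProbabilityMeasure_inv_smul_restrict {α : Type*} [MeasurableSpace α] {μ : Measure α}
    {B : Set α} (h0 : μ B ≠ 0) (ht : μ B ≠ ∞) :
    IsProbabilityMeasure ((μ B)⁻¹ • μ.restrict B) :=
  ⟨by rw [Measure.smul_apply, Measure.restrict_apply_univ, smul_eq_mul,
    ENNReal.inv_mul_cancel h0 ht]⟩

lemma average_le_rpow_average {α : Type*} [MeasurableSpace α] {μ : Measure α} {B : Set α}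
    (h0 : μ B ≠ 0) (ht : μ B ≠ ∞) {g : α → ℝ≥0∞} (hg : AEMeasurable g μ) {q : ℝ} (hq : 1 ≤ q) :
    (∫⁻ y in B, g y ∂μ) / μ B ≤ ((∫⁻ y in B, g y ^ q ∂μ) / μ B) ^ (1 / q) := by
  have := isProbabilityMeasure_inv_smul_restrict h0 ht
  have key := eLpNorm'_le_eLpNorm'_of_exponent_le one_pos hq ((μ B)⁻¹ • μ.restrict B)
    (f := g) (hg.restrict.smul_measure _).aestronglyMeasurable
  simpa [eLpNorm', lintegral_smul_measure, ENNReal.div_eq_inv_mul] using key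

lemma volume_cubeSet_ne_zero {n : ℕ} (c : Rn n) {s : ℝ} (hs : 0 < s) :
    volume (cubeSet c s) ≠ 0 := by
  rw [volume_cubeSet c hs.le]
  exact pow_ne_zero _ (by simpa using hs)

lemma volume_cubeSet_ne_top {n : ℕ} (c : Rn n) {s : ℝ} (hs : 0 < s) :
    volume (cubeSet c s) ≠ ∞ := by
  rw [volume_cubeSet c hs.le]
  finiteness

lemma eLpNorm_cube_le_of_morreyNorm_le {n : ℕ} {ε : Type*} [ENorm ε] {p b : ℝ≥0∞}
    {φ : Rn n → ℝ → ℝ} (hφ : ∀ x r, 0 < r → 0 < φ x r) {f : Rn n → ε} (h : morreyNorm p φ f ≤ b)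
    (c : Rn n) {s : ℝ}
    (hs : 0 < s) :
    eLpNorm f p ((volume (cubeSet c s))⁻¹ • volume.restrict (cubeSet c s)) ≤
      b * ENNReal.ofReal (φ c s) := by
  have := (le_iSup (fun Q : Cube n => eLpNorm f p ((volume Q.toSet)⁻¹ • volume.restrict Q.toSet) /
    ENNReal.ofReal (φ Q.center Q.side)) ⟨c, s, hs⟩).trans h
  rwa [ENNReal.div_le_iff (by simpa using hφ c s hs) ENNReal.ofReal_ne_top] at this

lemma eLpNorm_cube_eq {n : ℕ} {ε : Type*} [TopologicalSpace ε] [ContinuousENorm ε]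
    {q : ℝ} (hq : 0 < q) (f : Rn n → ε)
    (c : Rn n) {s : ℝ} (hs : 0 < s) :
    eLpNorm f (ENNReal.ofReal q) ((volume (cubeSet c s))⁻¹ • volume.restrict (cubeSet c s)) =
      ((ENNReal.ofReal s ^ n)⁻¹ * ∫⁻ x in cubeSet c s, ‖f x‖ₑ ^ q) ^ (1 / q) := by
  rw [eLpNorm_eq_lintegral_rpow_enorm_toReal (by simpa using hq) ENNReal.ofReal_ne_top,
    ENNReal.toReal_ofReal hq.le, lintegral_smul_measure, volume_cubeSet c hs.le, smul_eq_mul]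

/-- Hölder for the normalised measure on the cube lowers the exponent `p` to a finite real `q`,
which also covers `p = ∞`. -/
lemma lintegral_cube_le_of_morreyNorm_le {n : ℕ} {ε : Type*} [TopologicalSpace ε]
    [ContinuousENorm ε] {q : ℝ} (hq : 0 < q) {p b : ℝ≥0∞}
    (hqp : ENNReal.ofReal q ≤ p) {φ : Rn n → ℝ → ℝ}
    (hφ : ∀ x r, 0 < r → 0 < φ x r) {f : Rn n → ε} (hf : AEStronglyMeasurable f volume)
    (h : morreyNorm p φ f ≤ b) (c : Rn n) {s : ℝ} (hs : 0 < s) :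
    ∫⁻ x in cubeSet c s, ‖f x‖ₑ ^ q ≤
      ENNReal.ofReal s ^ n * (b * ENNReal.ofReal (φ c s)) ^ q := by
  have := isProbabilityMeasure_inv_smul_restrict (volume_cubeSet_ne_zero c hs)
    (volume_cubeSet_ne_top c hs)
  have h1 := (eLpNorm_le_eLpNorm_of_exponent_le hqp (hf.restrict.smul_measure _)).trans
    (eLpNorm_cube_le_of_morreyNorm_le hφ h c hs)
  rw [eLpNorm_cube_eq hq f c hs, one_div, ENNReal.rpow_inv_le_iff hq,
    ENNReal.inv_mul_le_iff (pow_ne_zero _ (by simpa using hs)) (by finiteness)] at h1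
  exact h1

/-- Local maximal estimate: if the `q`-averages of `g` over cubes are bounded by `e η`, then so are
the `p`-averages of the maximal function, `p < q`. -/
lemma exists_lintegral_maximalFn_rpow_le {n : ℕ} (hn : 0 < n) {p q : ℝ} (hp0 : 0 < p) (hp1 : p ≤ 1)
    (hq : 1 ≤ q) (hpq : p < q) {η : Rn n → ℝ → ℝ} (hη : GClass 1 η) :
    ∃ K : ℝ≥0∞, K ≠ ∞ ∧ ∀ (g : Rn n → ℝ≥0∞) (e : ℝ), AEMeasurable g → 0 < e →
      (∀ c s, 0 < s → ∫⁻ x in cubeSet c s, g x ^ q ≤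
        ENNReal.ofReal s ^ n * ENNReal.ofReal (e * η c s) ^ q) →
      ∀ c s, 0 < s → ∫⁻ x in cubeSet c s, maximalFn g x ^ p ≤
        K * (ENNReal.ofReal s ^ n * ENNReal.ofReal (e * η c s) ^ p) := by
  have hq0 : 0 < q := by linarith
  obtain ⟨K, hK, hKol⟩ := exists_kolmogorov_bound (s := p / q) (by positivity)
    ((div_lt_one hq0).2 hpq) (W := 12 ^ n) (by finiteness)
  set v := volume (Metric.ball (0 : Rn n) 1) with hv
  have hv0 : v ≠ 0 := (Metric.measure_ball_pos _ _ one_pos).ne'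
  have hvt : v ≠ ∞ := measure_ball_lt_top.ne
  refine ⟨K + (6 ^ n / v) ^ p, ENNReal.add_ne_top.2 ⟨hK, ENNReal.rpow_ne_top_of_nonneg hp0.le
    (ENNReal.div_ne_top (by finiteness) hv0)⟩, ?_⟩
  intro g e hg he hgq c s hs
  have hηpos := hη.pos c s hs
  set T := ENNReal.ofReal (e * η c s) with hT
  have hT0 : T ≠ 0 := by
    rw [hT, ne_eq, ENNReal.ofReal_eq_zero, not_le]
    positivity
  have hTt : T ≠ ∞ := ENNReal.ofReal_ne_top
  have hTle : ∀ r, s ≤ r → ENNReal.ofReal (e * η c r) ≤ T := fun r hr =>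
    ENNReal.ofReal_le_ofReal (by gcongr; exact hη.anti c s r hs hr)
  set g₃ : Rn n → ℝ≥0∞ := (cubeSet c (3 * s)).indicator fun x => g x ^ q with hg₃
  -- A ball through `x` inside the tripled cube sees only `g₃`, and Jensen moves the power `q`
  -- inside the average. Any other ball has `s ≤ 2 * r` and fits in the concentric cube of side `6 *
  -- r`, where the hypothesis on `g` and the monotonicity of `η` bound the average by a multiple of
  -- `T`.
  have hptw : ∀ x ∈ cubeSet c s, maximalFn g x ≤ maximalFn g₃ x ^ (1 / q) + 6 ^ n / v * T := by
    intro x hx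
    refine maximalFn_le fun c' r hxB => ?_
    have hr : 0 < r := dist_nonneg.trans_lt hxB
    have hB0 : volume (Metric.ball c' r) ≠ 0 := (Metric.measure_ball_pos _ _ hr).ne'
    have hBt : volume (Metric.ball c' r) ≠ ∞ := measure_ball_lt_top.ne
    by_cases hsub : Metric.ball c' r ⊆ cubeSet c (3 * s)
    · refine le_trans ?_ le_self_add
      refine (average_le_rpow_average hB0 hBt hg hq).trans ?_
      refine ENNReal.rpow_le_rpow ?_ (by positivity)
      rw [setLIntegral_congr_fun (g := g₃) measurableSet_ball (fun y hy => by
        rw [hg₃, Set.indicator_of_mem (hsub hy)])]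
      exact average_le_maximalFn g₃ hxB
    · refine le_trans ?_ le_add_self
      obtain ⟨z, hzB, hz⟩ := Set.not_subset.1 hsub
      have hdist : ∀ y ∈ Metric.ball c' r, ∀ i, |y i - x i| ≤ 2 * r := by
        intro y hy i
        have h1 : dist y x ≤ 2 * r := by
          have := dist_triangle_right y x c'
          rw [Metric.mem_ball] at hy hxB
          linarith
        rw [dist_eq_norm] at h1
        have h2 := PiLp.norm_apply_le (y - x) i
        rw [PiLp.sub_apply, Real.norm_eq_abs] at h2
        linarith
      have hsr : s ≤ 2 * r := by
        simp only [cubeSet, Set.mem_ofPred_eq, not_forall, not_le] at hz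
        obtain ⟨i, hi⟩ := hz
        have h1 := hdist z hzB i
        have h2 := hx i
        have h3 := abs_sub_le (z i) (x i) (c i)
        linarith
      have hsub6 : Metric.ball c' r ⊆ cubeSet c (6 * r) := by
        intro y hy i
        have h1 := hdist y hy i
        have h2 := hx i
        have h3 := abs_sub_le (y i) (x i) (c i)
        linarith
      have h6 : 0 < 6 * r := by positivity
      have h7 : (∫⁻ y in cubeSet c (6 * r), g y) ≤ ENNReal.ofReal (6 * r) ^ n * T := by
        have h8 := average_le_rpow_average (volume_cubeSet_ne_zero c h6)
          (volume_cubeSet_ne_top c h6) hg hq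
        rw [ENNReal.div_le_iff (volume_cubeSet_ne_zero c h6)
          (volume_cubeSet_ne_top c h6)] at h8
        refine h8.trans ?_
        rw [volume_cubeSet c h6.le, mul_comm]
        gcongr
        rw [one_div, ENNReal.rpow_inv_le_iff hq0]
        refine ENNReal.div_le_of_le_mul ?_
        rw [mul_comm (T ^ q)]
        refine (hgq c (6 * r) h6).trans ?_
        gcongr
        exact hTle _ (by linarith)
      refine ENNReal.div_le_of_le_mul ?_
      calc (∫⁻ y in Metric.ball c' r, g y) ≤ ∫⁻ y in cubeSet c (6 * r), g y :=
            lintegral_mono_set hsub6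
        _ ≤ ENNReal.ofReal (6 * r) ^ n * T := h7
        _ = 6 ^ n * (v⁻¹ * v) * T * ENNReal.ofReal r ^ n := by
            rw [ENNReal.ofReal_mul (by norm_num), mul_pow, ENNReal.inv_mul_cancel hv0 hvt]
            norm_num
            ring
        _ = 6 ^ n / v * T * volume (Metric.ball c' r) := by
            rw [volume_ball_eq c' hr, ← hv, div_eq_mul_inv]
            ring
  have hTq0 : T ^ q ≠ 0 := (ENNReal.rpow_pos (pos_iff_ne_zero.2 hT0) hTt).ne'
  have hTqt : T ^ q ≠ ∞ := ENNReal.rpow_ne_top_of_nonneg hq0.le hTt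
  have hweak : ∀ t : ℝ≥0∞, t ≠ 0 → t ≠ ∞ →
      t * volume.restrict (cubeSet c s) {x | t < maximalFn g₃ x} ≤
        12 ^ n * volume (cubeSet c s) * T ^ q := by
    intro t ht0 ht
    calc t * volume.restrict (cubeSet c s) {x | t < maximalFn g₃ x}
        ≤ t * volume {x | t < maximalFn g₃ x} := by
          gcongr
          exact Measure.restrict_le_self
      _ ≤ 4 ^ n * ∫⁻ x, g₃ x := mul_volume_maximalFn_le hn g₃ ht0 ht
      _ = 4 ^ n * ∫⁻ x in cubeSet c (3 * s), g x ^ q := by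
          rw [hg₃, lintegral_indicator (measurableSet_cubeSet c _)]
      _ ≤ 4 ^ n * (ENNReal.ofReal (3 * s) ^ n * T ^ q) := by
          gcongr
          refine (hgq c (3 * s) (by positivity)).trans ?_
          gcongr
          exact hTle _ (by linarith)
      _ = 12 ^ n * volume (cubeSet c s) * T ^ q := by
          rw [volume_cubeSet c hs.le, ENNReal.ofReal_mul (by norm_num),
            show (12 : ℝ≥0∞) = 4 * 3 by norm_num, mul_pow, mul_pow]
          norm_num
          ring
  -- Kolmogorov with exponent `p / q < 1`, applied to the maximal function of `g ^ q`, for which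
  -- only a weak `L¹` bound is available when `q = 1` is allowed.
  have hKb := hKol volume (cubeSet c s) (maximalFn g₃) (T ^ q) (measurable_maximalFn _) hTq0 hTqt
    hweak
  rw [← ENNReal.rpow_mul, mul_div_cancel₀ _ hq0.ne', volume_cubeSet c hs.le] at hKb
  calc ∫⁻ x in cubeSet c s, maximalFn g x ^ p
      ≤ ∫⁻ x in cubeSet c s, (maximalFn g₃ x ^ (p / q) + (6 ^ n / v * T) ^ p) := by
        refine setLIntegral_mono' (measurableSet_cubeSet c s) fun x hx => ?_
        refine (ENNReal.rpow_le_rpow (hptw x hx) hp0.le).trans ?_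
        refine (ENNReal.rpow_add_le_add_rpow _ _ hp0.le hp1).trans (le_of_eq ?_)
        rw [← ENNReal.rpow_mul]
        ring_nf
    _ = (∫⁻ x in cubeSet c s, maximalFn g₃ x ^ (p / q)) +
        (6 ^ n / v * T) ^ p * ENNReal.ofReal s ^ n := by
        rw [lintegral_add_right _ measurable_const, lintegral_const, Measure.restrict_apply_univ,
          volume_cubeSet c hs.le]
    _ ≤ K * ENNReal.ofReal s ^ n * T ^ p + (6 ^ n / v * T) ^ p * ENNReal.ofReal s ^ n := by
        gcongr
    _ = _ := by
        rw [ENNReal.mul_rpow_of_nonneg _ _ hp0.le]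
        ring

/-! ### Admissible kernels -/

/-- A kernel concentrated around `x` at scale `t`, with the decay of an approximate identity, whose
`m`-th derivative has the decay of the heat kernel. -/
structure AdmissibleAt {n : ℕ} (m : ℕ) (x : Rn n) (t A : ℝ) (κ : Rn n → ℂ) : Prop where
  decay : ∀ y, (t + ‖x - y‖) ^ (n + 1) * ‖κ y‖ ≤ A * t
  deriv : ∀ y, (t + ‖x - y‖) ^ (n + m) * ‖iteratedFDeriv ℝ m κ y‖ ≤ A

lemma AdmissibleAt.nonneg {n m : ℕ} {x : Rn n} {t A : ℝ} {κ : Rn n → ℂ} (ht : 0 ≤ t)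
    (h : AdmissibleAt m x t A κ) : 0 ≤ A :=
  le_trans (by positivity) (h.deriv x)

/-- A kernel with decay is dominated by a sum of weighted indicators of the balls of radius `2 ^ k *
t` about `x`. The decay exponent `n + 1` beats the volume by one power, so weight times volume is of
order `A * 2 ^ (-k)`. -/
lemma exists_lintegral_mul_admissible_le (n : ℕ) :
    ∃ K : ℝ≥0∞, K ≠ ∞ ∧ ∀ (m : ℕ) (g : Rn n → ℝ≥0∞) (x : Rn n) (t A : ℝ) (κ : Rn n → ℂ),
      AEMeasurable g → 0 < t → AdmissibleAt m x t A κ →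
      ∫⁻ y, g y * ‖κ y‖ₑ ≤ K * ENNReal.ofReal A * maximalFn g x := by
  set v := volume (Metric.ball (0 : Rn n) 1) with hv
  refine ⟨2 ^ (n + 1) * (1 - 2⁻¹)⁻¹ * v, ?_, ?_⟩
  · refine ENNReal.mul_ne_top (ENNReal.mul_ne_top (by finiteness) ?_) measure_ball_lt_top.ne
    rw [ENNReal.one_sub_inv_two, inv_inv]
    norm_num
  intro m g x t A κ hg ht hκ
  have hA := hκ.nonneg ht.le
  let w : ℕ → ℝ≥0∞ := fun k => ENNReal.ofReal (A * 2 ^ (n + 1) * t / (2 ^ k * t) ^ (n + 1))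
  have hptw : ∀ y, ‖κ y‖ₑ ≤ ∑' k : ℕ, (Metric.ball x (2 ^ k * t)).indicator (fun _ => w k) y := by
    intro y
    have hxy := norm_nonneg (x - y)
    obtain ⟨j, hj1, hj2⟩ := exists_nat_pow_near (x := (t + ‖x - y‖) / t) (y := 2)
      (by rw [le_div_iff₀ ht]; linarith) (by norm_num)
    rw [le_div_iff₀ ht] at hj1
    rw [div_lt_iff₀ ht] at hj2
    refine le_trans ?_ (ENNReal.le_tsum (j + 1))
    rw [Set.indicator_of_mem (by rw [Metric.mem_ball, dist_comm, dist_eq_norm]; linarith)]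
    rw [← ofReal_norm]
    apply ENNReal.ofReal_le_ofReal
    rw [le_div_iff₀ (by positivity)]
    calc ‖κ y‖ * (2 ^ (j + 1) * t) ^ (n + 1) = 2 ^ (n + 1) * ((2 ^ j * t) ^ (n + 1) * ‖κ y‖) := by
          rw [pow_succ 2 j, mul_comm ((2 : ℝ) ^ j) 2, mul_assoc 2, mul_pow 2]
          ring
      _ ≤ 2 ^ (n + 1) * ((t + ‖x - y‖) ^ (n + 1) * ‖κ y‖) := by gcongr
      _ ≤ 2 ^ (n + 1) * (A * t) := 
          mul_le_mul_of_nonneg_left (hκ.decay y) (by positivity)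
      _ = _ := by ring
  calc ∫⁻ y, g y * ‖κ y‖ₑ
      ≤ ∫⁻ y, ∑' k : ℕ, (Metric.ball x (2 ^ k * t)).indicator (fun y => w k * g y) y := by
        refine lintegral_mono fun y => ?_
        refine (mul_le_mul_right (hptw y) (g y)).trans (le_of_eq ?_)
        rw [← ENNReal.tsum_mul_left]
        congr 1
        ext k
        by_cases hy : y ∈ Metric.ball x (2 ^ k * t)
        · simp only [Set.indicator_of_mem hy]; ring
        · simp only [Set.indicator_of_notMem hy, mul_zero]
    _ = ∑' k : ℕ, w k * ∫⁻ y in Metric.ball x (2 ^ k * t), g y := by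
        rw [lintegral_tsum fun k => (hg.const_mul _).indicator measurableSet_ball]
        congr 1
        ext k
        rw [lintegral_indicator measurableSet_ball, lintegral_const_mul'' _ hg.restrict]
    _ ≤ ∑' k : ℕ, w k * (maximalFn g x * volume (Metric.ball x (2 ^ k * t))) := by
        gcongr with k
        exact lintegral_ball_le_maximalFn g (Metric.mem_ball_self (by positivity))
    _ = ∑' k : ℕ, (2 ^ (n + 1) * v * ENNReal.ofReal A * maximalFn g x) * (2⁻¹) ^ k := by
        congr 1
        ext k
        rw [volume_ball_eq x (by positivity), ← hv]
        have e : w k * ENNReal.ofReal (2 ^ k * t) ^ n =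
            2 ^ (n + 1) * ENNReal.ofReal A * (2⁻¹) ^ k := by
          have e2 : (2⁻¹ : ℝ≥0∞) = ENNReal.ofReal (2⁻¹) := by
            rw [ENNReal.ofReal_inv_of_pos (by norm_num)]; norm_num
          have e3 : (2 : ℝ≥0∞) ^ (n + 1) = ENNReal.ofReal (2 ^ (n + 1)) := by
            rw [ENNReal.ofReal_pow (by norm_num)]; norm_num
          rw [e2, e3, ← ENNReal.ofReal_pow (by positivity), ← ENNReal.ofReal_pow (by positivity),
            ← ENNReal.ofReal_mul (by positivity), ← ENNReal.ofReal_mul (by positivity),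
            ← ENNReal.ofReal_mul (by positivity)]
          congr 1
          rw [pow_succ (2 ^ k * t) n, inv_pow]
          field_simp
        calc _ = (w k * ENNReal.ofReal (2 ^ k * t) ^ n) * v * maximalFn g x := by ring
          _ = _ := by rw [e]; ring
    _ = _ := by
        rw [ENNReal.tsum_mul_left, ENNReal.tsum_geometric]
        ring

/-! ### Cancellation -/

lemma multilinear_diagonal_eq {n k : ℕ} (f : ContinuousMultilinearMap ℝ (fun _ : Fin k => Rn n) ℂ)
    (v : Rn n) :
    f (fun _ => v) = ∑ r : Fin k → Fin n,
      ((∏ i, v (r i) : ℝ) : ℂ) * f (fun i => EuclideanSpace.single (r i) 1) := by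
  have hv : v = ∑ j, v j • EuclideanSpace.single j (1 : ℝ) := by
    ext i
    simp [Pi.single_apply]
  conv_lhs => rw [hv]
  rw [ContinuousMultilinearMap.map_sum]
  refine Finset.sum_congr rfl fun r _ => ?_
  rw [ContinuousMultilinearMap.map_smul_univ, Complex.real_smul]

lemma integrableOn_mul_cube {n : ℕ} {c : Rn n} {s : ℝ} (hs : 0 ≤ s) {a : Rn n → ℂ}
    (ha : IntegrableOn a (cubeSet c s)) {u : Rn n → ℂ} (hu : Continuous u) :
    IntegrableOn (fun y => a y * u y) (cubeSet c s) := by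
  have hc : IsCompact (cubeSet c s) := by
    rw [cubeSet_eq_preimage c hs]
    exact (PiLp.homeomorph 2 (fun _ : Fin n => ℝ)).isCompact_preimage.2 (isCompact_closedBall _ _)
  exact ha.mul_continuousOn hu.continuousOn hc

/-- A Taylor term at `c` is a polynomial in `y` of degree at most `k < m`. Expanding the products of
`y i - c i` in `MvPolynomial` reduces it to moments about the origin, the ones assumed to vanish. -/
lemma integral_mul_multilinear_eq_zero {n m k : ℕ} {c : Rn n} {s : ℝ} (hs : 0 ≤ s) {a : Rn n → ℂ}
    (ha : IntegrableOn a (cubeSet c s))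
    (hmom : ∀ α : Fin n → ℕ, ∑ i, α i < m →
      ∫ x in cubeSet c s, a x * ∏ i, ((x i : ℝ) : ℂ) ^ α i = 0) (hk : k < m)
    (f : ContinuousMultilinearMap ℝ (fun _ : Fin k => Rn n) ℂ) :
    ∫ y in cubeSet c s, a y * f (fun _ => y - c) = 0 := by
  have hmon : ∀ r : Fin k → Fin n,
      ∫ y in cubeSet c s, a y * ((∏ i, (y - c) (r i) : ℝ) : ℂ) = 0 := by
    intro r
    let P : MvPolynomial (Fin n) ℂ :=
      ∏ i, (MvPolynomial.X (r i) - MvPolynomial.C ((c (r i) : ℝ) : ℂ))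
    have hdeg : P.totalDegree ≤ k := by
      refine (MvPolynomial.totalDegree_finsetProd _ _).trans ?_
      calc _ ≤ ∑ _i : Fin k, 1 := Finset.sum_le_sum fun i _ =>
            (MvPolynomial.totalDegree_sub_C_le _ _).trans (by simp)
        _ = k := by simp
    have hP : ∀ y : Rn n, ((∏ i, (y - c) (r i) : ℝ) : ℂ) =
        ∑ α ∈ P.support, P.coeff α * ∏ i, ((y i : ℝ) : ℂ) ^ α i := by
      intro y
      rw [← MvPolynomial.eval_eq' (fun i => ((y i : ℝ) : ℂ)) P]
      simp [P]
    simp_rw [hP, Finset.mul_sum]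
    rw [integral_finsetSum _ fun α _ => integrableOn_mul_cube hs ha (by fun_prop)]
    refine Finset.sum_eq_zero fun α hα => ?_
    have h1 : ∑ i, α i < m := by
      have := (MvPolynomial.le_totalDegree hα).trans hdeg
      rw [Finsupp.sum_fintype _ _ (fun _ => rfl)] at this
      omega
    calc _ = ∫ y in cubeSet c s, P.coeff α * (a y * ∏ i, ((y i : ℝ) : ℂ) ^ α i) := by
          congr 1; ext y; ring
      _ = 0 := by rw [integral_const_mul, hmom _ h1, mul_zero]
  simp_rw [multilinear_diagonal_eq f, Finset.mul_sum]
  rw [integral_finsetSum _ fun r _ => integrableOn_mul_cube hs ha (by fun_prop)]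
  refine Finset.sum_eq_zero fun r _ => ?_
  simp_rw [← mul_assoc]
  rw [integral_mul_const, hmon, zero_mul]

lemma norm_le_of_mem_cubeSet {n : ℕ} {c y : Rn n} {s : ℝ} (hy : y ∈ cubeSet c s) :
    ‖y - c‖ ≤ n * (s / 2) := by
  have h : ‖y - c‖ ≤ ∑ i, ‖(y - c) i‖ := by
    have hv : y - c = ∑ j, (y - c) j • EuclideanSpace.single j (1 : ℝ) := by
      ext i
      simp [Pi.single_apply]
    conv_lhs => rw [hv]
    refine (norm_sum_le _ _).trans (Finset.sum_le_sum fun i _ => ?_)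
    simp [norm_smul]
  refine h.trans ?_
  calc _ ≤ ∑ _i : Fin n, s / 2 := Finset.sum_le_sum fun i _ => by simpa using hy i
    _ = _ := by simp

/-- Subtracting the Taylor polynomial of degree `m - 1` at `c` does not change the integral. The
remainder is of order `s ^ m` times the `m`-th derivative, which is at most `A / ρ ^ (n + m)` on the
cube; with the mass `s ^ n` of the atom all powers of `s` cancel. -/
lemma enorm_integral_mul_admissible_le_far {n m : ℕ} (hn : 0 < n) (hm : 0 < m)
    {c x : Rn n} {s t A : ℝ}
    (hs : 0 < s) (ht : 0 < t) {a : Rn n → ℂ} (haI : IntegrableOn a (cubeSet c s))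
    (ha1 : ∫⁻ y in cubeSet c s, ‖a y‖ₑ ≤ ENNReal.ofReal s ^ n)
    (hsupp : ∀ᵐ y, y ∉ cubeSet c s → a y = 0)
    (hmom : ∀ α : Fin n → ℕ, ∑ i, α i < m →
      ∫ x in cubeSet c s, a x * ∏ i, ((x i : ℝ) : ℂ) ^ α i = 0)
    {κ : Rn n → ℂ} (hκs : ContDiff ℝ m κ) (hκ : AdmissibleAt m x t A κ) {k : ℕ}
    (hx : x ∉ cubeSet c (2 * n * 2 ^ k * s)) :
    ‖∫ y, a y * κ y‖ₑ ≤
      ENNReal.ofReal ((n / 2) ^ m * 2 ^ (n + m)) * ENNReal.ofReal A * ((2⁻¹) ^ (n + m)) ^ k := by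
  obtain ⟨m, rfl⟩ : ∃ l, m = l + 1 := ⟨m - 1, by omega⟩
  have hA := hκ.nonneg ht.le
  have hn1 : (1 : ℝ) ≤ n := by exact_mod_cast hn
  have hk1 : (1 : ℝ) ≤ 2 ^ k := one_le_pow₀ (by norm_num)
  have hxc : n * 2 ^ k * s ≤ ‖x - c‖ := by
    simp only [cubeSet, Set.mem_ofPred_eq, not_forall, not_le] at hx
    obtain ⟨i, hi⟩ := hx
    have h2 := PiLp.norm_apply_le (x - c) i
    rw [PiLp.sub_apply, Real.norm_eq_abs] at h2
    linarith
  -- Points of the cube are within `n * s / 2` of `c` and `‖x - c‖ ≥ n * 2 ^ k * s`, so the segment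
  -- from `c` to any such point stays at distance at least `ρ` from `x`.
  set ρ : ℝ := 2 ^ k * s / 2 with hρ
  have hρ0 : 0 < ρ := by positivity
  set R : Rn n → ℂ := fun y => κ y - ∑ j ∈ Finset.range (m + 1),
    (j.factorial : ℝ)⁻¹ • iteratedFDeriv ℝ j κ c (fun _ => y - c) with hR
  have hRb : ∀ y ∈ cubeSet c s, ‖R y‖ ≤ A / ρ ^ (n + (m + 1)) * (n * (s / 2)) ^ (m + 1) := by
    intro y hy
    have hyc := norm_le_of_mem_cubeSet hy
    have hT := map_add_eq_sum_add_integral_iteratedFDeriv (f := κ) (x := c) (y := y - c) (n := m)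
      (fun _ _ => by exact_mod_cast hκs.contDiffAt)
    rw [add_sub_cancel] at hT
    have hRy : R y = (m.factorial : ℝ)⁻¹ • ∫ t in (0 : ℝ)..1, (1 - t) ^ m •
        iteratedFDeriv ℝ (m + 1) κ (c + t • (y - c)) (fun _ => y - c) := by
      rw [hR]
      simp only
      rw [hT]
      ring
    have hint : ‖∫ t in (0 : ℝ)..1, (1 - t) ^ m •
        iteratedFDeriv ℝ (m + 1) κ (c + t • (y - c)) (fun _ => y - c)‖ ≤
        A / ρ ^ (n + (m + 1)) * (n * (s / 2)) ^ (m + 1) * |(1 : ℝ) - 0| := by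
      refine intervalIntegral.norm_integral_le_of_norm_le_const fun τ hτ => ?_
      rw [Set.uIoc_of_le zero_le_one] at hτ
      have h1 : |(1 - τ) ^ m| ≤ 1 := by
        rw [abs_of_nonneg (pow_nonneg (by linarith [hτ.2]) _)]
        exact pow_le_one₀ (by linarith [hτ.2]) (by linarith [hτ.1])
      have hd : ρ ≤ t + ‖x - (c + τ • (y - c))‖ := by
        have h3 : ‖x - c‖ ≤ ‖x - (c + τ • (y - c))‖ + ‖τ • (y - c)‖ := by
          have := norm_add_le (x - (c + τ • (y - c))) (τ • (y - c))
          rwa [show x - (c + τ • (y - c)) + τ • (y - c) = x - c by abel] at this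
        have h4 : ‖τ • (y - c)‖ ≤ n * (s / 2) := by
          rw [norm_smul, Real.norm_eq_abs, abs_of_pos hτ.1]
          calc τ * ‖y - c‖ ≤ 1 * ‖y - c‖ := by gcongr; exact hτ.2
            _ ≤ _ := by rw [one_mul]; exact hyc
        have h5 : n * s ≤ n * 2 ^ k * s := by
          rw [mul_assoc]
          gcongr
          exact le_mul_of_one_le_left hs.le hk1
        have h6 : 2 ^ k * s ≤ n * 2 ^ k * s := by
          rw [mul_assoc]
          exact le_mul_of_one_le_left (by positivity) hn1
        rw [hρ]
        linarith
      have h2 : ‖iteratedFDeriv ℝ (m + 1) κ (c + τ • (y - c))‖ ≤ A / ρ ^ (n + (m + 1)) := by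
        rw [le_div_iff₀' (by positivity)]
        refine le_trans ?_ (hκ.deriv (c + τ • (y - c)))
        gcongr
      rw [norm_smul, Real.norm_eq_abs]
      calc _ ≤ 1 * (A / ρ ^ (n + (m + 1)) * (n * (s / 2)) ^ (m + 1)) := by
            gcongr
            refine (ContinuousMultilinearMap.le_opNorm _ _).trans ?_
            rw [Finset.prod_const, Finset.card_univ, Fintype.card_fin]
            gcongr
        _ = _ := one_mul _
    rw [hRy, norm_smul]
    calc _ ≤ 1 * (A / ρ ^ (n + (m + 1)) * (n * (s / 2)) ^ (m + 1) * |(1 : ℝ) - 0|) := by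
          gcongr
          rw [norm_inv, Real.norm_natCast]
          exact inv_le_one_of_one_le₀ (by exact_mod_cast Nat.one_le_iff_ne_zero.2 m.factorial_ne_zero)
      _ = _ := by simp
  have hcube : ∫ y, a y * κ y = ∫ y in cubeSet c s, a y * κ y := by
    rw [setIntegral_eq_integral_of_ae_compl_eq_zero]
    filter_upwards [hsupp] with y hy hyc
    rw [hy hyc, zero_mul]
  have hcontj : ∀ j, Continuous fun y : Rn n =>
      (j.factorial : ℝ)⁻¹ • iteratedFDeriv ℝ j κ c (fun _ => y - c) := fun j => by
    have h : Continuous fun y : Rn n => iteratedFDeriv ℝ j κ c (fun _ => y - c) :=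
      (iteratedFDeriv ℝ j κ c).cont.comp (f := fun y _ => y - c) (by fun_prop)
    fun_prop
  have hRint : ∫ y in cubeSet c s, a y * κ y = ∫ y in cubeSet c s, a y * R y := by
    simp_rw [hR, mul_sub]
    rw [integral_sub (integrableOn_mul_cube hs.le haI hκs.continuous)
      (integrableOn_mul_cube hs.le haI (continuous_finsetSum _ fun j _ => hcontj j))]
    simp_rw [Finset.mul_sum]
    rw [integral_finsetSum _ fun j _ => integrableOn_mul_cube hs.le haI (hcontj j),
      Finset.sum_eq_zero, sub_zero]
    intro j hj
    simp_rw [mul_smul_comm]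
    rw [integral_smul, integral_mul_multilinear_eq_zero hs.le haI hmom (Finset.mem_range.1 hj),
      smul_zero]
  rw [hcube, hRint]
  calc ‖∫ y in cubeSet c s, a y * R y‖ₑ
      ≤ ∫⁻ y in cubeSet c s, ‖a y * R y‖ₑ := enorm_integral_le_lintegral_enorm _
    _ ≤ ∫⁻ y in cubeSet c s, ENNReal.ofReal (A / ρ ^ (n + (m + 1)) * (n * (s / 2)) ^ (m + 1)) * ‖a y‖ₑ := by
        refine setLIntegral_mono' (measurableSet_cubeSet c s) fun y hy => ?_
        rw [enorm_mul, mul_comm]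
        gcongr
        rw [← ofReal_norm]
        exact ENNReal.ofReal_le_ofReal (hRb y hy)
    _ ≤ ENNReal.ofReal (A / ρ ^ (n + (m + 1)) * (n * (s / 2)) ^ (m + 1)) * ENNReal.ofReal s ^ n := by
        rw [lintegral_const_mul' _ _ ENNReal.ofReal_ne_top]
        gcongr
    _ = _ := by
        have e2 : (2⁻¹ : ℝ≥0∞) = ENNReal.ofReal (2⁻¹) := by
          rw [ENNReal.ofReal_inv_of_pos (by norm_num)]; norm_num
        rw [e2, ← ENNReal.ofReal_pow hs.le, ← ENNReal.ofReal_pow (by positivity),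
          ← ENNReal.ofReal_pow (by positivity), ← ENNReal.ofReal_mul (by positivity),
          ← ENNReal.ofReal_mul (by positivity), ← ENNReal.ofReal_mul (by positivity)]
        congr 1
        rw [hρ, inv_pow, inv_pow, ← pow_mul, mul_comm (n + (m + 1)) k, pow_mul,
          show (n : ℝ) * (s / 2) = n / 2 * s by ring, mul_pow ((n : ℝ) / 2), div_pow (_ * s),
          mul_pow _ s, pow_add s]
        generalize ((n : ℝ) / 2) ^ (m + 1) = X
        field_simp

/-! ### Schwartz functions as admissible kernels -/

/-- The rescaled translates of a Schwartz function are uniformly admissible. -/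
lemma exists_admissibleAt_rescale {n : ℕ} (m : ℕ) (g : 𝓢(Rn n, ℂ)) :
    ∃ A : ℝ, ∀ (x : Rn n) (s : ℝ), 0 < s →
      AdmissibleAt m x s A fun y => (s ^ n)⁻¹ • g (s⁻¹ • (y - x)) := by
  set N := n + m + 1 with hN
  set A : ℝ := 2 ^ N * (Finset.Iic (N, m)).sup (fun m => SchwartzMap.seminorm ℝ m.1 m.2) g with hA
  refine ⟨A, fun x s hs => ?_⟩
  -- In the variable `z = s⁻¹ • (y - x)` all powers of `s` cancel, leaving a Schwartz seminorm of
  -- `g`.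
  have hscale : ∀ y, s + ‖x - y‖ = s * (1 + ‖s⁻¹ • (y - x)‖) := by
    intro y
    rw [norm_smul, norm_inv, Real.norm_eq_abs, abs_of_pos hs, norm_sub_rev y x]
    field_simp
  constructor
  · intro y
    have h := SchwartzMap.one_add_le_sup_seminorm_apply (𝕜 := ℝ) (m := (N, m)) (k := n + 1) (n := 0)
      (by simp only; omega) (Nat.zero_le _) g (s⁻¹ • (y - x))
    rw [norm_iteratedFDeriv_zero] at h
    rw [hscale]
    generalize s⁻¹ • (y - x) = z at h ⊢
    rw [norm_smul, norm_inv, norm_pow, Real.norm_eq_abs, abs_of_pos hs]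
    calc _ = s * ((1 + ‖z‖) ^ (n + 1) * ‖g z‖) := by
          rw [mul_pow, pow_succ s n]
          field_simp
      _ ≤ s * A := mul_le_mul_of_nonneg_left h hs.le
      _ = A * s := mul_comm _ _
  · intro y
    have h := SchwartzMap.one_add_le_sup_seminorm_apply (𝕜 := ℝ) (m := (N, m)) (k := n + m) (n := m)
      (by simp only; omega) le_rfl g (s⁻¹ • (y - x))
    have hg : ContDiff ℝ m g := g.smooth m
    have hD : iteratedFDeriv ℝ m (fun y => (s ^ n)⁻¹ • g (s⁻¹ • (y - x))) y =
        (s ^ n)⁻¹ • (s⁻¹) ^ m • iteratedFDeriv ℝ m g (s⁻¹ • (y - x)) := by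
      rw [iteratedFDeriv_const_smul_apply' (f := fun y => g (s⁻¹ • (y - x)))
        (by fun_prop : ContDiff ℝ m _).contDiffAt]
      congr 1
      rw [iteratedFDeriv_comp_sub (f := fun z => g (s⁻¹ • z)), iteratedFDeriv_comp_const_smul _ hg]
    rw [hD, hscale]
    generalize s⁻¹ • (y - x) = z at h ⊢
    rw [norm_smul, norm_smul, norm_inv, norm_pow, norm_pow, norm_inv, Real.norm_eq_abs,
      abs_of_pos hs]
    calc _ = (1 + ‖z‖) ^ (n + m) * ‖iteratedFDeriv ℝ m g z‖ := by
          rw [mul_pow, pow_add s, inv_pow]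
          field_simp
      _ ≤ A := h

/-- The heat kernel at time `t` is the rescaling by `√t` of the kernel at time one, so a single
constant serves all times and points. -/
lemma exists_admissibleAt_heatKernel (n m : ℕ) :
    ∃ A : ℝ, ∀ (t : ℝ) (ht : 0 < t) (x : Rn n),
      AdmissibleAt m x (Real.sqrt t) A (heatKernel ht x) := by
  obtain ⟨A, hA⟩ := exists_admissibleAt_rescale m (heatKernel one_pos (0 : Rn n))
  refine ⟨A, fun t ht x => ?_⟩
  have hst : 0 < Real.sqrt t := Real.sqrt_pos.2 ht
  convert hA x (Real.sqrt t) hst using 1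
  ext y
  rw [heatKernel_apply, heatKernel_apply, Complex.real_smul, ← Complex.ofReal_mul]
  congr 1
  have h1 : Real.sqrt ((4 * Real.pi * t) ^ n) =
      Real.sqrt ((4 * Real.pi * 1) ^ n) * Real.sqrt t ^ n := by
    rw [mul_one, mul_pow, Real.sqrt_mul (by positivity)]
    congr 1
    rw [Real.sqrt_eq_iff_mul_self_eq (by positivity) (by positivity), ← mul_pow,
      Real.mul_self_sqrt ht.le]
  have h2 : -‖0 - (Real.sqrt t)⁻¹ • (y - x)‖ ^ 2 / (4 * 1) = -‖x - y‖ ^ 2 / (4 * t) := by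
    rw [zero_sub, norm_neg, norm_smul, norm_inv, Real.norm_eq_abs, abs_of_pos hst, mul_pow, inv_pow,
      Real.sq_sqrt ht.le, norm_sub_rev y x]
    field_simp
  rw [h1, h2]
  field_simp

/-- This makes the pairing estimate at one fixed point a seminorm bound on the atomic series. The
factor `(1 + ‖x‖) ^ N` pays for moving the centre from the origin to `x`. -/
lemma exists_admissibleAt_one {n : ℕ} (m : ℕ) (x : Rn n) :
    ∃ C : ℝ, 0 ≤ C ∧ ∀ κ : 𝓢(Rn n, ℂ), AdmissibleAt m x 1
      (C * (Finset.Iic (n + m + 1, m)).sup (schwartzSeminormFamily ℂ (Rn n) ℂ) κ) κ := by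
  set N := n + m + 1 with hN
  refine ⟨(1 + ‖x‖) ^ N * 2 ^ N, by positivity, fun κ => ?_⟩
  have hx1 : 1 ≤ 1 + ‖x‖ := le_add_of_nonneg_right (norm_nonneg _)
  have hmul : ∀ (y : Rn n) (k : ℕ), k ≤ N →
      (1 + ‖x - y‖) ^ k ≤ (1 + ‖x‖) ^ N * (1 + ‖y‖) ^ k := by
    intro y k hk
    calc (1 + ‖x - y‖) ^ k ≤ ((1 + ‖x‖) * (1 + ‖y‖)) ^ k := by
          gcongr
          have := norm_sub_le x y
          nlinarith [norm_nonneg x, norm_nonneg y]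
      _ = (1 + ‖x‖) ^ k * (1 + ‖y‖) ^ k := mul_pow _ _ _
      _ ≤ _ := by gcongr
  constructor
  · intro y
    have h := SchwartzMap.one_add_le_sup_seminorm_apply (𝕜 := ℂ) (m := (N, m)) (k := n + 1) (n := 0)
      (by simp only; omega) (Nat.zero_le _) κ y
    rw [norm_iteratedFDeriv_zero] at h
    rw [mul_one, mul_assoc]
    refine le_trans ?_ (mul_le_mul_of_nonneg_left h (by positivity))
    rw [← mul_assoc]
    gcongr
    exact hmul y _ (by omega)
  · intro y
    have h := SchwartzMap.one_add_le_sup_seminorm_apply (𝕜 := ℂ) (m := (N, m)) (k := n + m) (n := m)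
      (by simp only; omega) le_rfl κ y
    rw [mul_assoc]
    refine le_trans ?_ (mul_le_mul_of_nonneg_left h (by positivity))
    rw [← mul_assoc]
    gcongr
    exact hmul y _ (by omega)

/-- Translation is continuous on Schwartz functions. -/
lemma continuous_compSubConstCLM {n : ℕ} (g : 𝓢(Rn n, ℂ)) :
    Continuous fun x : Rn n => g.compSubConstCLM ℂ x := by
  have h0 : Tendsto (fun x : Rn n => g.compSubConstCLM ℂ x) (𝓝 0) (𝓝 g) := by
    rw [(schwartz_withSeminorms ℂ (Rn n) ℂ).tendsto_nhds]
    rintro ⟨k, l⟩ ε hε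
    -- The constant of the mean value inequality on the unit ball about `y`: one factor `2 ^ k`
    -- comes from `1 + ‖y‖ ≤ 2 * (1 + ‖ξ‖)`, the other from the weighted seminorm estimate.
    set M : ℝ := 2 ^ k * (2 ^ k *
      (Finset.Iic (k, l + 1)).sup (fun m => SchwartzMap.seminorm ℝ m.1 m.2) g) with hM
    have hM0 : 0 ≤ M := by positivity
    have hbound : ∀ x : Rn n, ‖x‖ ≤ 1 →
        SchwartzMap.seminorm ℂ k l (g.compSubConstCLM ℂ x - g) ≤ M * ‖x‖ := by
      intro x hx
      refine SchwartzMap.seminorm_le_bound ℂ k l _ (by positivity) fun y => ?_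
      have hfd : ∀ ξ ∈ Metric.closedBall y 1,
          ‖fderiv ℝ (iteratedFDeriv ℝ l g) ξ‖ ≤ M / (1 + ‖y‖) ^ k := by
        intro ξ hξ
        rw [norm_fderiv_iteratedFDeriv, le_div_iff₀' (by positivity), hM]
        have h := SchwartzMap.one_add_le_sup_seminorm_apply (𝕜 := ℝ) (m := (k, l + 1)) (k := k)
          (n := l + 1) le_rfl le_rfl g ξ
        refine le_trans ?_ (mul_le_mul_of_nonneg_left h (by positivity))
        rw [← mul_assoc, ← mul_pow]
        gcongr
        rw [Metric.mem_closedBall, dist_comm, dist_eq_norm] at hξ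
        have := norm_le_norm_add_norm_sub' y ξ
        linarith [norm_nonneg ξ]
      have hmv := (convex_closedBall y 1).norm_image_sub_le_of_norm_fderiv_le (𝕜 := ℝ)
        (fun ξ _ => ((g.smooth (l + 1)).differentiable_iteratedFDeriv
          (by exact_mod_cast Nat.lt_succ_self l)).differentiableAt) hfd
        (Metric.mem_closedBall_self zero_le_one)
        (show y - x ∈ Metric.closedBall y 1 by simpa [dist_eq_norm] using hx)
      have hsub : iteratedFDeriv ℝ l (g.compSubConstCLM ℂ x - g : 𝓢(Rn n, ℂ)) y =
          iteratedFDeriv ℝ l g (y - x) - iteratedFDeriv ℝ l g y := by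
        have h1 : ⇑(g.compSubConstCLM ℂ x) = fun y => g (y - x) := rfl
        have h2 : ⇑(g.compSubConstCLM ℂ x - g) = ⇑(g.compSubConstCLM ℂ x) - ⇑g := rfl
        rw [h2, iteratedFDeriv_sub_apply
          ((g.compSubConstCLM ℂ x).smooth l).contDiffAt (g.smooth l).contDiffAt, h1,
          iteratedFDeriv_comp_sub]
      rw [hsub]
      rw [sub_sub_cancel_left, norm_neg] at hmv
      calc _ ≤ (1 + ‖y‖) ^ k * (M / (1 + ‖y‖) ^ k * ‖x‖) := by
            gcongr
            linarith
        _ = M * ‖x‖ := by field_simp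
    have htend : Tendsto (fun x : Rn n => M * ‖x‖) (𝓝 0) (𝓝 0) := by
      have : Continuous fun x : Rn n => M * ‖x‖ := by fun_prop
      simpa using this.tendsto 0
    filter_upwards [htend.eventually_lt_const hε, Metric.closedBall_mem_nhds (0 : Rn n) one_pos]
      with x hx hx1
    exact (hbound x (by simpa using hx1)).trans_lt hx
  rw [continuous_iff_continuousAt]
  intro x₀
  -- Translations compose, so continuity at the origin transfers to `x₀`.
  have h1 : (fun x : Rn n => g.compSubConstCLM ℂ x) =
      fun x => (g.compSubConstCLM ℂ (x - x₀)).compSubConstCLM ℂ x₀ := by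
    ext1 x
    rw [SchwartzMap.compSubConstCLM_comp, sub_add_cancel]
  have h2 : Tendsto (fun x : Rn n => x - x₀) (𝓝 x₀) (𝓝 0) := by
    have : Continuous fun x : Rn n => x - x₀ := by fun_prop
    simpa using this.tendsto x₀
  rw [ContinuousAt, h1]
  exact ((SchwartzMap.compSubConstCLM ℂ x₀).continuous.tendsto g).comp (h0.comp h2)

lemma continuous_heatKernel {n : ℕ} {t : ℝ} (ht : 0 < t) :
    Continuous fun x : Rn n => heatKernel ht x := by
  have := continuous_compSubConstCLM (gaussian n (b := 1 / (4 * t)) (by positivity))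
  unfold heatKernel
  fun_prop

/-- The supremum runs over uncountably many `t`, so measurability comes from lower semicontinuity:
each `e^{tΔ} f` is continuous. -/
lemma measurable_heatMax {n : ℕ} (f : 𝓢'(Rn n, ℂ)) : Measurable (heatMax f) := by
  refine LowerSemicontinuous.measurable ?_
  refine lowerSemicontinuous_iSup fun t => lowerSemicontinuous_iSup fun ht => ?_
  exact ((f.continuous.comp (continuous_heatKernel ht)).enorm).lowerSemicontinuous

/-! ### Majorants of atoms -/

lemma tsum_rpow_le_tsum_rpow {p : ℝ} (hp0 : 0 < p) (hp1 : p ≤ 1) (u : ℕ → ℝ≥0∞) :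
    (∑' j, u j) ^ p ≤ ∑' j, u j ^ p := by
  rw [← ENNReal.le_rpow_inv_iff hp0]
  refine ENNReal.tsum_le_of_sum_range_le fun N => ?_
  rw [ENNReal.le_rpow_inv_iff hp0]
  refine le_trans ?_ (ENNReal.sum_le_tsum (Finset.range N))
  induction N with
  | zero => simp [hp0]
  | succ N ih =>
    rw [Finset.sum_range_succ, Finset.sum_range_succ]
    exact (ENNReal.rpow_add_le_add_rpow _ _ hp0.le hp1).trans (by gcongr)

/-- The part of the majorant of an atom near its cube. -/
def nearMajorant {n : ℕ} (p : ℝ) (Q : Cube n) (a : Rn n → ℂ) (x : Rn n) : ℝ≥0∞ :=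
  (cubeSet Q.center (2 * n * Q.side)).indicator (fun x => maximalFn (fun y => ‖a y‖ₑ) x ^ p) x

/-- The indicator of the `k`-th dilate of a cube. -/
def dilateIndicator {n : ℕ} (k : ℕ) (Q : Cube n) (x : Rn n) : ℝ≥0∞ :=
  (cubeSet Q.center (2 * n * 2 ^ (k + 1) * Q.side)).indicator (fun _ => 1) x

/-- A pointwise majorant for the `p`-th powers of the pairings of an atom with admissible kernels. -/
def majorant {n : ℕ} (m : ℕ) (p : ℝ) (Q : Cube n) (a : Rn n → ℂ) (x : Rn n) : ℝ≥0∞ :=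
  nearMajorant p Q a x + ∑' k : ℕ, ((((2⁻¹ : ℝ≥0∞) ^ (n + m)) ^ p) ^ k) * dilateIndicator k Q x

lemma measurable_nearMajorant {n : ℕ} (p : ℝ) (Q : Cube n) (a : Rn n → ℂ) :
    Measurable (nearMajorant p Q a) :=
  ((measurable_maximalFn _).pow_const p).indicator (measurableSet_cubeSet _ _)

lemma measurable_dilateIndicator {n : ℕ} (k : ℕ) (Q : Cube n) : Measurable (dilateIndicator k Q) :=
  measurable_const.indicator (measurableSet_cubeSet _ _)

lemma measurable_majorant {n : ℕ} (m : ℕ) (p : ℝ) (Q : Cube n) (a : Rn n → ℂ) :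
    Measurable (majorant m p Q a) :=
  (measurable_nearMajorant p Q a).add
    (Measurable.tsum fun k => (measurable_dilateIndicator k Q).const_mul _)

/-- The normalized properties of an atom which the estimates use. -/
structure IsAtom {n : ℕ} (m : ℕ) (q : ℝ) (η : Rn n → ℝ → ℝ) (Q : Cube n) (a : Rn n → ℂ) : Prop where
  aestronglyMeasurable : AEStronglyMeasurable a volume
  lintegral_rpow_le : ∀ c s, 0 < s → ∫⁻ x in cubeSet c s, ‖a x‖ₑ ^ q ≤
    ENNReal.ofReal s ^ n * ENNReal.ofReal (1 / η Q.center Q.side * η c s) ^ q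
  lintegral_le : ∫⁻ x in cubeSet Q.center Q.side, ‖a x‖ₑ ≤ ENNReal.ofReal Q.side ^ n
  eq_zero : ∀ᵐ x, x ∉ cubeSet Q.center Q.side → a x = 0
  moment : ∀ α : Fin n → ℕ, ∑ i, α i < m →
    ∫ x in cubeSet Q.center Q.side, a x * ∏ i, ((x i : ℝ) : ℂ) ^ α i = 0

namespace IsAtom

variable {n m : ℕ} {q : ℝ} {η : Rn n → ℝ → ℝ} {Q : Cube n} {a : Rn n → ℂ}

lemma integrableOn (h : IsAtom m q η Q a) : IntegrableOn a (cubeSet Q.center Q.side) :=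
  ⟨h.aestronglyMeasurable.restrict, h.lintegral_le.trans_lt (by finiteness)⟩

lemma integrable_mul (h : IsAtom m q η Q a) {κ : Rn n → ℂ} (hκ : Continuous κ) :
    Integrable fun x => a x * κ x := by
  refine (integrableOn_mul_cube Q.side_pos.le h.integrableOn hκ).integrable_of_ae_notMem_eq_zero ?_
  filter_upwards [h.eq_zero] with x hx hxQ
  rw [hx hxQ, zero_mul]

end IsAtom

/-- The near part uses only the size of the atom, the far part its cancellation. Neither sees the
scale `t`, so the bound survives the supremum over `t`. -/
lemma exists_pairing_rpow_le_majorant {n m : ℕ} (hn : 0 < n) (hm : 0 < m) {p : ℝ} (hp0 : 0 < p) :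
    ∃ K : ℝ≥0∞, K ≠ ∞ ∧ ∀ {q : ℝ} {η : Rn n → ℝ → ℝ} {Q : Cube n} {a : Rn n → ℂ},
      IsAtom m q η Q a → ∀ {x : Rn n} {t A : ℝ} {κ : Rn n → ℂ}, 0 < t → ContDiff ℝ m κ →
      AdmissibleAt m x t A κ →
      ‖∫ y, a y * κ y‖ₑ ^ p ≤ K * ENNReal.ofReal A ^ p * majorant m p Q a x := by
  obtain ⟨K₁, hK₁, hnear⟩ := exists_lintegral_mul_admissible_le n
  set K₂ := ENNReal.ofReal (((n : ℝ) / 2) ^ m * 2 ^ (n + m)) with hK₂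
  refine ⟨K₁ ^ p + K₂ ^ p, ENNReal.add_ne_top.2 ⟨ENNReal.rpow_ne_top_of_nonneg hp0.le hK₁,
    ENNReal.rpow_ne_top_of_nonneg hp0.le ENNReal.ofReal_ne_top⟩, ?_⟩
  intro q η Q a ha x t A κ ht hκs hκ
  have hs := Q.side_pos
  have hn0 : (0 : ℝ) < n := by exact_mod_cast hn
  by_cases hx : x ∈ cubeSet Q.center (2 * n * Q.side)
  · have h1 : ‖∫ y, a y * κ y‖ₑ ≤ K₁ * ENNReal.ofReal A * maximalFn (fun y => ‖a y‖ₑ) x := by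
      refine (enorm_integral_le_lintegral_enorm _).trans ?_
      simp_rw [enorm_mul]
      exact hnear m _ x t A κ ha.aestronglyMeasurable.enorm ht hκ
    calc _ ≤ (K₁ * ENNReal.ofReal A * maximalFn (fun y => ‖a y‖ₑ) x) ^ p :=
          ENNReal.rpow_le_rpow h1 hp0.le
      _ = K₁ ^ p * ENNReal.ofReal A ^ p * nearMajorant p Q a x := by
          rw [ENNReal.mul_rpow_of_nonneg _ _ hp0.le, ENNReal.mul_rpow_of_nonneg _ _ hp0.le,
            nearMajorant, Set.indicator_of_mem hx]
      _ ≤ _ := by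
          gcongr
          · exact le_self_add
          · exact le_self_add
  · have hex : ∃ k : ℕ, x ∈ cubeSet Q.center (2 * n * 2 ^ k * Q.side) := by
      obtain ⟨k, hk⟩ := pow_unbounded_of_one_lt (‖x - Q.center‖ / (n * Q.side))
        (one_lt_two : (1 : ℝ) < 2)
      rw [div_lt_iff₀ (by positivity)] at hk
      refine ⟨k, fun i => ?_⟩
      have := PiLp.norm_apply_le (x - Q.center) i
      rw [PiLp.sub_apply, Real.norm_eq_abs] at this
      linarith
    classical
    -- The least dilate containing `x` is not the zeroth, so `x` lies in dilate `k + 1` and outside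
    -- dilate `k`.
    obtain ⟨k, hk⟩ : ∃ k, Nat.find hex = k + 1 := by
      refine Nat.exists_eq_succ_of_ne_zero fun h0 => hx ?_
      have := Nat.find_spec hex
      rw [h0] at this
      simpa using this
    have hin : x ∈ cubeSet Q.center (2 * n * 2 ^ (k + 1) * Q.side) := by
      have := Nat.find_spec hex
      rwa [hk] at this
    have hout : x ∉ cubeSet Q.center (2 * n * 2 ^ k * Q.side) :=
      Nat.find_min hex (by omega)
    have h1 := enorm_integral_mul_admissible_le_far hn hm hs ht ha.integrableOn ha.lintegral_le
      ha.eq_zero ha.moment hκs hκ hout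
    calc _ ≤ (K₂ * ENNReal.ofReal A * ((2⁻¹) ^ (n + m)) ^ k) ^ p :=
          ENNReal.rpow_le_rpow h1 hp0.le
      _ = K₂ ^ p * ENNReal.ofReal A ^ p *
          ((((2⁻¹ : ℝ≥0∞) ^ (n + m)) ^ p) ^ k * dilateIndicator k Q x) := by
          rw [ENNReal.mul_rpow_of_nonneg _ _ hp0.le, ENNReal.mul_rpow_of_nonneg _ _ hp0.le,
            dilateIndicator, Set.indicator_of_mem hin, mul_one, ← ENNReal.rpow_natCast _ k,
            ← ENNReal.rpow_mul, mul_comm (k : ℝ) p, ENNReal.rpow_mul, ENNReal.rpow_natCast]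
      _ ≤ _ := by
          gcongr
          · exact le_add_self
          · refine le_trans ?_ le_add_self
            exact ENNReal.le_tsum (f := fun k => (((2⁻¹ : ℝ≥0∞) ^ (n + m)) ^ p) ^ k *
              dilateIndicator k Q x) k

/-- The weighted sum of the majorants has the same averages as the packing of cubes. -/
lemma exists_sum_lintegral_majorant_le {n m : ℕ} (hn : 0 < n) {p q : ℝ} (hp0 : 0 < p) (hp1 : p ≤ 1)
    (hpm : (n : ℝ) < p * (n + m)) (hq : 1 ≤ q) (hpq : p < q) {φ η : Rn n → ℝ → ℝ}
    (hφ : GClass 1 φ) (hη : GClass 1 η)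
    (hint : ∃ C : ℝ, ∀ (x : Rn n) (r : ℝ), 0 < r →
      ∫⁻ s in Set.Ioi r, ENNReal.ofReal (φ x s / (η x s * s)) ≤
        ENNReal.ofReal (C * (φ x r / η x r))) :
    ∃ K : ℝ≥0∞, K ≠ ∞ ∧ ∀ (Q : ℕ → Cube n) (L : ℕ → ℝ≥0∞) (A : ℝ≥0∞) (a : ℕ → Rn n → ℂ),
      Packing p φ Q L A → (∀ j, IsAtom m q η (Q j) (a j)) → ∀ c s, 0 < s →
      ∫⁻ x in cubeSet c s, ∑' j, L j * majorant m p (Q j) (a j) x ≤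
        K * (A * ENNReal.ofReal (φ c s) ^ p * ENNReal.ofReal s ^ n) := by
  obtain ⟨K₁, hK₁, hsum⟩ := exists_packing_sum_le hp0 hφ hη hint
  obtain ⟨K₂, hK₂, hmax⟩ := exists_lintegral_maximalFn_rpow_le hn hp0 hp1 hq hpq hη
  obtain ⟨C, hC, hgrow⟩ := hη.exists_growth
  have hn1 : (1 : ℝ) ≤ n := by exact_mod_cast hn
  set w : ℝ≥0∞ := ((2⁻¹ : ℝ≥0∞) ^ (n + m)) ^ p with hw
  -- Here the number of moments matters: `w` is the decay of the far part per dyadic step, `2 ^ n`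
  -- the cost of one more dilation in the packing sum.
  have hr : w * 2 ^ n < 1 := by
    have : w * 2 ^ n = 2 ^ ((n : ℝ) - p * (n + m)) := by
      rw [hw, ENNReal.rpow_sub _ _ (by norm_num) (by norm_num), ENNReal.rpow_natCast,
        ← ENNReal.inv_pow, ENNReal.inv_rpow, ← ENNReal.rpow_natCast 2 (n + m), ← ENNReal.rpow_mul,
        div_eq_mul_inv, mul_comm p]
      push_cast
      ring
    rw [this]
    exact ENNReal.rpow_lt_one_of_one_lt_of_neg (by norm_num) (by linarith)
  set M₁ : ℝ≥0∞ := K₂ * ENNReal.ofReal (2 * n) ^ n with hM₁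
  set M₂ : ℝ≥0∞ := K₂ * ENNReal.ofReal (C * 2 ^ n) ^ p with hM₂
  refine ⟨K₁ * (M₁ + M₂ * ENNReal.ofReal (2 * n) ^ n) +
    K₁ * (2 * ENNReal.ofReal (4 * n) ^ n) * (1 - w * 2 ^ n)⁻¹, ?_, ?_⟩
  · have hM₁t : M₁ ≠ ∞ := ENNReal.mul_ne_top hK₂ (by finiteness)
    have hM₂t : M₂ ≠ ∞ := ENNReal.mul_ne_top hK₂
      (ENNReal.rpow_ne_top_of_nonneg hp0.le ENNReal.ofReal_ne_top)
    have hinv : (1 - w * 2 ^ n)⁻¹ ≠ ∞ := ENNReal.inv_ne_top.2 (tsub_pos_of_lt hr).ne'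
    exact ENNReal.add_ne_top.2 ⟨ENNReal.mul_ne_top hK₁ (ENNReal.add_ne_top.2
      ⟨hM₁t, ENNReal.mul_ne_top hM₂t (by finiteness)⟩),
      ENNReal.mul_ne_top (ENNReal.mul_ne_top hK₁ (by finiteness)) hinv⟩
  intro Q L A a hpack ha c s hs
  set X := A * ENNReal.ofReal (φ c s) ^ p * ENNReal.ofReal s ^ n with hX
  have hnear : ∑' j, L j * ∫⁻ x in cubeSet c s, nearMajorant p (Q j) (a j) x ≤
      K₁ * (M₁ + M₂ * ENNReal.ofReal (2 * n) ^ n) * X := by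
    have hloc : ∀ j c s, 0 < s → ∫⁻ x in cubeSet c s, maximalFn (fun y => ‖a j y‖ₑ) x ^ p ≤
        K₂ * (ENNReal.ofReal s ^ n *
          ENNReal.ofReal (1 / η (Q j).center (Q j).side * η c s) ^ p) := fun j =>
      hmax _ _ (ha j).aestronglyMeasurable.enorm (one_div_pos.2 (hη.pos _ _ (Q j).side_pos)) (ha j).lintegral_rpow_le
    refine hsum Q L A hpack (2 * n) M₁ M₂ (fun j => nearMajorant p (Q j) (a j)) (by linarith)
      (fun j x hx => Set.indicator_of_notMem hx _) (fun j => ?_) (fun j c s hs hsD hmeet => ?_) c s hs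
    · have hl := (Q j).side_pos
      have hηl := hη.pos (Q j).center _ hl
      unfold nearMajorant
      rw [lintegral_indicator (measurableSet_cubeSet _ _)]
      refine (hloc j (Q j).center (2 * n * (Q j).side) (by positivity)).trans ?_
      have h1 : ENNReal.ofReal (1 / η (Q j).center (Q j).side *
          η (Q j).center (2 * n * (Q j).side)) ^ p ≤ 1 := by
        refine ENNReal.rpow_le_one ?_ hp0.le
        rw [← ENNReal.ofReal_one]
        apply ENNReal.ofReal_le_ofReal
        rw [one_div, inv_mul_le_iff₀ hηl, mul_one]
        exact hη.anti _ _ _ hl (le_mul_of_one_le_left hl.le (by linarith))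
      calc _ ≤ K₂ * (ENNReal.ofReal (2 * n * (Q j).side) ^ n * 1) := by gcongr
        _ = _ := by
          rw [hM₁, ENNReal.ofReal_mul (by positivity), mul_pow]
          ring
    · have hl := (Q j).side_pos
      have hηl := hη.pos (Q j).center _ hl
      set r := 2 * n * (Q j).side with hr
      have hr0 : 0 < r := by positivity
      have hlr : (Q j).side ≤ r := le_mul_of_one_le_left hl.le (by linarith)
      have hηr := hη.pos c r hr0
      have hηs := hη.pos c s hs
      -- The cubes meet and `s ≤ r`, so the cube of side `r` about `c` lies in the cube of side `2 *
      -- r` about the centre of `Q j`. Growth then changes the centre, and monotonicity returns to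
      -- the side of `Q j`.
      have hcomp : η c r ≤ C * 2 ^ n * η (Q j).center (Q j).side := by
        have h1 := hgrow (Q j).center c r (2 * r) hr0 (by positivity)
          ((norm_sub_le_of_inter hs.le hr0.le hmeet).trans (by linarith))
        have h2 := hη.anti (Q j).center (Q j).side (2 * r) hl (by linarith)
        have h3 : η c r * r ^ n ≤ (C * 2 ^ n * η (Q j).center (2 * r)) * r ^ n := by
          rw [mul_pow 2 r] at h1
          refine h1.trans (le_of_eq ?_)
          ring
        refine (le_of_mul_le_mul_right h3 (by positivity)).trans ?_
        gcongr
      calc ∫⁻ x in cubeSet c s, nearMajorant p (Q j) (a j) x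
          ≤ ∫⁻ x in cubeSet c s, maximalFn (fun y => ‖a j y‖ₑ) x ^ p :=
            lintegral_mono fun x => Set.indicator_le_self _ _ _
        _ ≤ K₂ * (ENNReal.ofReal s ^ n *
            ENNReal.ofReal (1 / η (Q j).center (Q j).side * η c s) ^ p) := hloc j c s hs
        _ ≤ K₂ * (ENNReal.ofReal s ^ n * ENNReal.ofReal ((C * 2 ^ n) * (η c s / η c r)) ^ p) := by
            refine mul_le_mul_right (mul_le_mul_right
              (ENNReal.rpow_le_rpow (ENNReal.ofReal_le_ofReal ?_) hp0.le) _) _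
            rw [one_div, inv_mul_le_iff₀ hηl]
            calc η c s = η c r * (η c s / η c r) := by field_simp
              _ ≤ (C * 2 ^ n * η (Q j).center (Q j).side) * (η c s / η c r) := by gcongr
              _ = _ := by ring
        _ = _ := by
            rw [ENNReal.ofReal_mul (by positivity), ENNReal.mul_rpow_of_nonneg _ _ hp0.le, hM₂]
            ring
  have hfar : ∀ k : ℕ, ∑' j, L j * ∫⁻ x in cubeSet c s, dilateIndicator k (Q j) x ≤
      K₁ * (2 * ENNReal.ofReal (4 * n) ^ n) * X * (2 ^ n) ^ k := by
    intro k
    have hk1 : (1 : ℝ) ≤ 2 ^ (k + 1) := one_le_pow₀ (by norm_num)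
    have hD1 : (1 : ℝ) ≤ 2 * n * 2 ^ (k + 1) := by nlinarith
    refine (hsum Q L A hpack (2 * n * 2 ^ (k + 1)) (ENNReal.ofReal (2 * n * 2 ^ (k + 1)) ^ n) 1
      (fun j => dilateIndicator k (Q j)) hD1
      (fun j x hx => Set.indicator_of_notMem hx _) (fun j => ?_)
      (fun j c s hs hsD hmeet => ?_) c s hs).trans (le_of_eq ?_)
    · have hl := (Q j).side_pos
      unfold dilateIndicator
      rw [lintegral_indicator (measurableSet_cubeSet _ _), lintegral_const, one_mul,
        Measure.restrict_apply_univ, volume_cubeSet _ (by positivity),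
        ENNReal.ofReal_mul (by positivity), mul_pow]
    -- For indicators the local bound is trivial, since `η` decreases and the ratio is at least one.
    · have h1 : (1 : ℝ≥0∞) ≤
          ENNReal.ofReal (η c s / η c (2 * n * 2 ^ (k + 1) * (Q j).side)) ^ p := by
        refine ENNReal.one_le_rpow ?_ hp0
        rw [← ENNReal.ofReal_one]
        apply ENNReal.ofReal_le_ofReal
        have := hη.pos c (2 * n * 2 ^ (k + 1) * (Q j).side) (hs.trans_le hsD)
        rw [le_div_iff₀ this, one_mul]
        exact hη.anti _ _ _ hs hsD
      calc ∫⁻ x in cubeSet c s, dilateIndicator k (Q j) x ≤ ∫⁻ x in cubeSet c s, 1 :=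
            lintegral_mono fun x => Set.indicator_le_self _ _ _
        _ = ENNReal.ofReal s ^ n := by
            rw [lintegral_const, one_mul, Measure.restrict_apply_univ, volume_cubeSet c hs.le]
        _ ≤ _ := by
            rw [one_mul]
            exact le_mul_of_one_le_right' h1
    · have h1 : ENNReal.ofReal (2 * n * 2 ^ (k + 1)) ^ n =
          ENNReal.ofReal (4 * n) ^ n * (2 ^ n) ^ k := by
        rw [← pow_mul, mul_comm n k, pow_mul, ← mul_pow]
        congr 1
        rw [show (2 : ℝ≥0∞) = ENNReal.ofReal 2 by norm_num, ← ENNReal.ofReal_pow (by norm_num),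
          ← ENNReal.ofReal_mul (by positivity)]
        congr 1
        ring
      rw [h1]
      ring
  calc ∫⁻ x in cubeSet c s, ∑' j, L j * majorant m p (Q j) (a j) x
      = ∑' j, (L j * ∫⁻ x in cubeSet c s, nearMajorant p (Q j) (a j) x) +
        ∑' k : ℕ, w ^ k * ∑' j, L j * ∫⁻ x in cubeSet c s, dilateIndicator k (Q j) x := by
        rw [lintegral_tsum fun j => ((measurable_majorant m p (Q j) (a j)).const_mul _).aemeasurable]
        simp_rw [← ENNReal.tsum_mul_left]
        rw [ENNReal.tsum_comm (α := ℕ) (β := ℕ), ← ENNReal.tsum_add]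
        congr 1
        ext j
        rw [lintegral_const_mul _ (measurable_majorant m p (Q j) (a j))]
        unfold majorant
        rw [lintegral_add_left (measurable_nearMajorant p (Q j) (a j)),
          lintegral_tsum fun k => ((measurable_dilateIndicator k (Q j)).const_mul _).aemeasurable,
          mul_add, ← ENNReal.tsum_mul_left]
        congr 1
        congr 1
        ext k
        rw [lintegral_const_mul _ (measurable_dilateIndicator k (Q j)), ← hw]
        ring
    _ ≤ K₁ * (M₁ + M₂ * ENNReal.ofReal (2 * n) ^ n) * X +
        ∑' k : ℕ, w ^ k * (K₁ * (2 * ENNReal.ofReal (4 * n) ^ n) * X * (2 ^ n) ^ k) := by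
        refine add_le_add hnear (ENNReal.tsum_le_tsum fun k => ?_)
        gcongr
        exact hfar k
    _ = _ := by
        have : ∀ k : ℕ, w ^ k * (K₁ * (2 * ENNReal.ofReal (4 * n) ^ n) * X * (2 ^ n) ^ k) =
            (K₁ * (2 * ENNReal.ofReal (4 * n) ^ n) * X) * (w * 2 ^ n) ^ k := fun k => by
          rw [mul_pow]; ring
        simp_rw [this]
        rw [ENNReal.tsum_mul_left, ENNReal.tsum_geometric]
        ring

/-! ### The atomic decomposition -/

lemma isAtom_of_morreyNorm_le {n m : ℕ} {q : ℝ} (hq : 1 ≤ q) {r : ℝ≥0∞} (hqr : ENNReal.ofReal q ≤ r)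
    {η : Rn n → ℝ → ℝ} (hη : GClass 1 η) {Q : Cube n} {a : Rn n → ℂ} (ha : MemMorrey r η a)
    (hnorm : morreyNorm r η a ≤ ENNReal.ofReal (1 / η Q.center Q.side))
    (hsupp : ∀ᵐ x, x ∉ Q.toSet → a x = 0)
    (hmom : ∀ α : Fin n → ℕ, ∑ i, α i < m →
      ∫ x in Q.toSet, a x * ∏ i, ((x i : ℝ) : ℂ) ^ α i = 0) : IsAtom m q η Q a where
  aestronglyMeasurable := ha.1
  lintegral_rpow_le c s hs := by
    refine (lintegral_cube_le_of_morreyNorm_le (by linarith) hqr hη.pos ha.1 hnorm c hs).trans ?_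
    rw [ENNReal.ofReal_mul (one_div_pos.2 (hη.pos _ _ Q.side_pos)).le]
  lintegral_le := by
    have hη0 := hη.pos Q.center Q.side Q.side_pos
    have h := lintegral_cube_le_of_morreyNorm_le one_pos
      ((ENNReal.ofReal_le_ofReal hq).trans hqr) hη.pos ha.1 hnorm Q.center Q.side_pos
    rw [← ENNReal.ofReal_mul (by positivity), one_div_mul_cancel hη0.ne'] at h
    simpa using h
  eq_zero := hsupp
  moment := hmom

lemma Cube.measurableSet_toSet {n : ℕ} (Q : Cube n) : MeasurableSet Q.toSet :=
  measurableSet_cubeSet Q.center Q.side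

lemma measurable_cubeSum {n : ℕ} (p : ℝ) (lam : ℕ → ℝ) (Q : ℕ → Cube n) :
    Measurable (cubeSum p lam Q) :=
  (Measurable.tsum fun j => (measurable_const.indicator
    (Q j).measurableSet_toSet).pow_const p).pow_const _

/-- Integrate the `p`-th power of `cubeSum` over the test cube: a cube contained in it contributes
its full volume, and the other terms are dropped. -/
lemma packing_of_morreyNorm_cubeSum {n : ℕ} {p : ℝ} (hp0 : 0 < p) {φ : Rn n → ℝ → ℝ}
    (hφ : GClass 1 φ) (lam : ℕ → ℝ) (Q : ℕ → Cube n) :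
    Packing p φ Q (fun j => ENNReal.ofReal (lam j) ^ p)
      (morreyNorm (ENNReal.ofReal p) φ (cubeSum p lam Q) ^ p) := by
  intro c s hs
  have h := lintegral_cube_le_of_morreyNorm_le hp0 le_rfl hφ.pos
    (measurable_cubeSum p lam Q).aestronglyMeasurable le_rfl c hs
  rw [ENNReal.mul_rpow_of_nonneg _ _ hp0.le, mul_comm] at h
  refine le_trans ?_ h
  have hpow : ∀ x, ‖cubeSum p lam Q x‖ₑ ^ p =
      ∑' j, ((Q j).toSet.indicator (fun _ => ENNReal.ofReal (lam j)) x) ^ p := by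
    intro x
    rw [enorm_eq_self, cubeSum, ← ENNReal.rpow_mul, one_div_mul_cancel hp0.ne', ENNReal.rpow_one]
  simp_rw [hpow]
  rw [lintegral_tsum fun j => ((measurable_const.indicator
    (Q j).measurableSet_toSet).pow_const p).aemeasurable]
  refine ENNReal.tsum_le_tsum fun j => ?_
  split_ifs with hsub
  · have hl := (Q j).side_pos
    calc ENNReal.ofReal (lam j) ^ p * ENNReal.ofReal (Q j).side ^ n
        = ∫⁻ x in (Q j).toSet, ENNReal.ofReal (lam j) ^ p := by
          rw [lintegral_const, Measure.restrict_apply_univ]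
          congr 1
          exact (volume_cubeSet (Q j).center hl.le).symm
      _ = ∫⁻ x in (Q j).toSet, ((Q j).toSet.indicator (fun _ => ENNReal.ofReal (lam j)) x) ^ p :=
          setLIntegral_congr_fun (Q j).measurableSet_toSet fun x hx => by
            simp only [Set.indicator_of_mem hx]
      _ ≤ _ := lintegral_mono_set hsub
  · exact zero_le

/-- The sum of the pairings with multiples of atoms is controlled by the sum of the majorants. -/
lemma exists_tsum_pairing_le {n m : ℕ} (hn : 0 < n) (hm : 0 < m) {p : ℝ} (hp0 : 0 < p)
    (hp1 : p ≤ 1) :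
    ∃ K : ℝ≥0∞, K ≠ ∞ ∧ ∀ {q : ℝ} {η : Rn n → ℝ → ℝ} {Q : ℕ → Cube n} {a : ℕ → Rn n → ℂ}
      {lam : ℕ → ℝ}, (∀ j, 0 ≤ lam j) → (∀ j, IsAtom m q η (Q j) (a j)) →
      ∀ {x : Rn n} {t A : ℝ} {κ : Rn n → ℂ}, 0 < t → ContDiff ℝ m κ → AdmissibleAt m x t A κ →
      ∑' j, ‖(lam j : ℂ) * ∫ y, a j y * κ y‖ₑ ≤ K * ENNReal.ofReal A *
        (∑' j, ENNReal.ofReal (lam j) ^ p * majorant m p (Q j) (a j) x) ^ (1 / p) := by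
  obtain ⟨K, hK, h⟩ := exists_pairing_rpow_le_majorant (m := m) hn hm hp0
  refine ⟨K ^ (1 / p), ENNReal.rpow_ne_top_of_nonneg (by positivity) hK, ?_⟩
  intro q η Q a lam hlam ha x t A κ ht hκs hκ
  have hA : ENNReal.ofReal A = (ENNReal.ofReal A ^ p) ^ (1 / p) := by
    rw [← ENNReal.rpow_mul, mul_one_div_cancel hp0.ne', ENNReal.rpow_one]
  rw [hA, ← ENNReal.mul_rpow_of_nonneg _ _ (by positivity),
    ← ENNReal.mul_rpow_of_nonneg _ _ (by positivity), one_div, ENNReal.le_rpow_inv_iff hp0]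
  refine (tsum_rpow_le_tsum_rpow hp0 hp1 _).trans ?_
  rw [← ENNReal.tsum_mul_left]
  refine ENNReal.tsum_le_tsum fun j => ?_
  have hlj : ‖(lam j : ℂ)‖ₑ = ENNReal.ofReal (lam j) := by
    rw [← ofReal_norm, Complex.norm_real, Real.norm_of_nonneg (hlam j)]
  rw [enorm_mul, hlj, ENNReal.mul_rpow_of_nonneg _ _ hp0.le]
  calc _ ≤ ENNReal.ofReal (lam j) ^ p *
        (K * ENNReal.ofReal A ^ p * majorant m p (Q j) (a j) x) := by
        gcongr
        exact h (ha j) ht hκs hκ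
    _ = _ := by ring

/-- If the sum of the majorants is finite at one point, then the atomic series defines a tempered
distribution. -/
lemma exists_distribution_of_majorant_ne_top {n m : ℕ} (hn : 0 < n) (hm : 0 < m) {p : ℝ}
    (hp0 : 0 < p) (hp1 : p ≤ 1) {q : ℝ} {η : Rn n → ℝ → ℝ} {Q : ℕ → Cube n} {a : ℕ → Rn n → ℂ}
    {lam : ℕ → ℝ} (hlam : ∀ j, 0 ≤ lam j) (ha : ∀ j, IsAtom m q η (Q j) (a j)) {x₀ : Rn n}
    (hx₀ : ∑' j, ENNReal.ofReal (lam j) ^ p * majorant m p (Q j) (a j) x₀ ≠ ∞) :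
    ∃ f : 𝓢'(Rn n, ℂ), ∀ κ : 𝓢(Rn n, ℂ),
      HasSum (fun j => (lam j : ℂ) * ∫ y, a j y * κ y) (f κ) := by
  obtain ⟨K, hK, h⟩ := exists_tsum_pairing_le (m := m) hn hm hp0 hp1
  obtain ⟨C, hC, hadm⟩ := exists_admissibleAt_one m x₀
  set S := ∑' j, ENNReal.ofReal (lam j) ^ p * majorant m p (Q j) (a j) x₀ with hS
  have hSt : S ^ (1 / p) ≠ ∞ := ENNReal.rpow_ne_top_of_nonneg (by positivity) hx₀
  have hbound : ∀ κ : 𝓢(Rn n, ℂ), ∑' j, ‖(lam j : ℂ) * ∫ y, a j y * κ y‖ₑ ≤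
      K * ENNReal.ofReal (C * (Finset.Iic (n + m + 1, m)).sup
        (schwartzSeminormFamily ℂ (Rn n) ℂ) κ) * S ^ (1 / p) := fun κ =>
    h hlam ha one_pos (κ.smooth m) (hadm κ)
  have hsum : ∀ κ : 𝓢(Rn n, ℂ), Summable fun j => (lam j : ℂ) * ∫ y, a j y * κ y := fun κ =>
    Summable.of_enorm (ne_top_of_le_ne_top
      (ENNReal.mul_ne_top (ENNReal.mul_ne_top hK ENNReal.ofReal_ne_top) hSt) (hbound κ))
  let F : 𝓢(Rn n, ℂ) →L[ℂ] ℂ := SchwartzMap.mkCLMtoNormedSpace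
    (fun κ => ∑' j, (lam j : ℂ) * ∫ y, a j y * κ y)
    (fun κ₁ κ₂ => by
      rw [← (hsum κ₁).tsum_add (hsum κ₂)]
      congr 1
      ext j
      rw [← mul_add, ← integral_add ((ha j).integrable_mul κ₁.continuous)
        ((ha j).integrable_mul κ₂.continuous)]
      simp only [add_apply, mul_add])
    (fun b κ => by
      simp only [smul_apply, smul_eq_mul, RingHom.id_apply]
      rw [← tsum_mul_left]
      congr 1
      ext j
      simp_rw [mul_left_comm _ b]
      rw [integral_const_mul]
      ring)
    ⟨Finset.Iic (n + m + 1, m), (K * S ^ (1 / p)).toReal * C, by positivity, fun κ => by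
      have h1 := (enorm_tsum_le_tsum_enorm (f := fun j => (lam j : ℂ) * ∫ y, a j y * κ y)).trans
        (hbound κ)
      have h2 := ENNReal.toReal_mono
        (ENNReal.mul_ne_top (ENNReal.mul_ne_top hK ENNReal.ofReal_ne_top) hSt) h1
      rw [toReal_enorm, ENNReal.toReal_mul, ENNReal.toReal_mul, ENNReal.toReal_ofReal (by positivity)]
        at h2
      refine h2.trans (le_of_eq ?_)
      rw [ENNReal.toReal_mul]
      ring⟩
  exact ⟨ContinuousLinearMap.toPointwiseConvergenceCLM _ _ _ _ F, fun κ => (hsum κ).hasSum⟩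

/-- The maximal estimates need a finite exponent; for `q = ∞` any real number above one would do. -/
lemma exists_real_exponent {p : ℝ} (hp1 : p ≤ 1) {q : ℝ≥0∞} (hq1 : 1 ≤ q)
    (hpq : ENNReal.ofReal p < q) : ∃ r : ℝ, 1 ≤ r ∧ p < r ∧ ENNReal.ofReal r ≤ q := by
  rcases eq_or_ne q ∞ with rfl | hq
  · exact ⟨2, by norm_num, by linarith, le_top⟩
  · refine ⟨q.toReal, by simpa using ENNReal.toReal_mono hq hq1, ?_, ENNReal.ofReal_toReal_le⟩
    by_contra! h
    exact absurd (ENNReal.ofReal_le_ofReal h) (by rwa [ENNReal.ofReal_toReal hq, not_le])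

end HardyMorrey

end

theorem theorem1p2 (n : ℕ) (hn : 0 < n) (p : ℝ) (hp0 : 0 < p) (hp1 : p ≤ 1)
    (d : ℝ) (hd : (n : ℝ) / p - n ≤ d)
    (q : ℝ≥0∞) (hq1 : 1 ≤ q) (hpq : ENNReal.ofReal p < q)
    (φ η : HardyMorrey.Rn n → ℝ → ℝ)
    (hφ : HardyMorrey.GClass 1 φ) (hη : HardyMorrey.GClass 1 η)
    (hint : ∃ C : ℝ, ∀ (x : HardyMorrey.Rn n) (r : ℝ), 0 < r →
      ∫⁻ s in Set.Ioi r, ENNReal.ofReal (φ x s / (η x s * s)) ≤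
        ENNReal.ofReal (C * (φ x r / η x r))) :
    ∃ C : ℝ, 0 < C ∧
      ∀ (Q : ℕ → HardyMorrey.Cube n) (a : ℕ → HardyMorrey.Rn n → ℂ) (lam : ℕ → ℝ),
        (∀ j, 0 ≤ lam j) →
        HardyMorrey.morreyNorm (ENNReal.ofReal p) φ (HardyMorrey.cubeSum p lam Q) < ∞ →
        (∀ j, HardyMorrey.MemMorrey q η (a j)) →
        (∀ j, HardyMorrey.morreyNorm q η (a j) ≤
          ENNReal.ofReal (1 / η (Q j).center (Q j).side)) →
        (∀ j, ∀ᵐ x, x ∉ (Q j).toSet → a j x = 0) →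
        (∀ j, ∀ α : Fin n → ℕ, ((∑ i, α i : ℕ) : ℝ) ≤ d →
          ∫ x in (Q j).toSet, a j x * ∏ i, ((x i : ℝ) : ℂ) ^ α i = 0) →
        ∃ f : 𝓢'(HardyMorrey.Rn n, ℂ),
          HardyMorrey.SumsTo (fun j x => (lam j : ℂ) * a j x) f ∧
          HardyMorrey.MemHardyMorrey (ENNReal.ofReal p) φ f ∧
          HardyMorrey.hardyMorreyNorm (ENNReal.ofReal p) φ f ≤
            ENNReal.ofReal C *
              HardyMorrey.morreyNorm (ENNReal.ofReal p) φ (HardyMorrey.cubeSum p lam Q) := by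
  open HardyMorrey in
  have hn1 : (1 : ℝ) ≤ n := by exact_mod_cast hn
  have hd0 : 0 ≤ d := by
    refine le_trans ?_ hd
    rw [sub_nonneg, le_div_iff₀ hp0]
    exact mul_le_of_le_one_right (by positivity) hp1
  obtain ⟨r, hr1, hpr, hrq⟩ := exists_real_exponent hp1 hq1 hpq
  -- For integers, being less than `m` is being at most `d`, so exactly the given moments are used.
  -- As `m > d`, the inequality `hpm` is strict even when `d = n / p - n`.
  set m : ℕ := ⌊d⌋₊ + 1 with hm
  have hpm : (n : ℝ) < p * (n + m) := by
    have h1 : d < m := by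
      rw [hm]
      push_cast
      exact Nat.lt_floor_add_one d
    rw [← div_lt_iff₀' hp0]
    linarith
  obtain ⟨K₁, hK₁, hint₁⟩ := exists_sum_lintegral_majorant_le hn hp0 hp1 hpm hr1 hpr hφ hη hint
  obtain ⟨K₂, hK₂, hpair⟩ := exists_tsum_pairing_le (m := m) hn (Nat.succ_pos _) hp0 hp1
  obtain ⟨A, hA⟩ := exists_admissibleAt_heatKernel n m
  set K : ℝ≥0∞ := K₂ * ENNReal.ofReal A * K₁ ^ (1 / p) with hK
  have hKt : K ≠ ∞ := ENNReal.mul_ne_top (ENNReal.mul_ne_top hK₂ ENNReal.ofReal_ne_top)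
    (ENNReal.rpow_ne_top_of_nonneg (by positivity) hK₁)
  refine ⟨K.toReal + 1, by positivity, ?_⟩
  intro Q a lam hlam hfin haM hanorm hasupp hamom
  set N := morreyNorm (ENNReal.ofReal p) φ (cubeSum p lam Q) with hN
  have hatom : ∀ j, IsAtom m r η (Q j) (a j) := fun j =>
    isAtom_of_morreyNorm_le hr1 hrq hη (haM j) (hanorm j) (hasupp j) fun α hα =>
      hamom j α ((Nat.le_floor_iff hd0).1 (by omega))
  set S : Rn n → ℝ≥0∞ := fun x =>
    ∑' j, ENNReal.ofReal (lam j) ^ p * majorant m p (Q j) (a j) x with hS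
  have hSmeas : Measurable S :=
    Measurable.tsum fun j => (measurable_majorant m p (Q j) (a j)).const_mul _
  have hSint : ∀ c s, 0 < s → ∫⁻ x in cubeSet c s, S x ≤
      K₁ * (N ^ p * ENNReal.ofReal (φ c s) ^ p * ENNReal.ofReal s ^ n) :=
    hint₁ Q _ _ a (packing_of_morreyNorm_cubeSum hp0 hφ lam Q) hatom
  -- One point of finiteness suffices for convergence against all Schwartz functions.
  obtain ⟨x₀, hx₀⟩ : ∃ x₀, S x₀ ≠ ∞ := by
    have hfinite : ∫⁻ x in cubeSet (0 : Rn n) 1, S x ≠ ∞ :=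
      ne_top_of_le_ne_top (ENNReal.mul_ne_top hK₁ (ENNReal.mul_ne_top (ENNReal.mul_ne_top
        (ENNReal.rpow_ne_top_of_nonneg hp0.le hfin.ne)
        (ENNReal.rpow_ne_top_of_nonneg hp0.le ENNReal.ofReal_ne_top)) (by finiteness)))
        (hSint 0 1 one_pos)
    have hae := ae_lt_top hSmeas hfinite
    have hne : (volume.restrict (cubeSet (0 : Rn n) 1)) ≠ 0 := by
      rw [ne_eq, Measure.restrict_eq_zero]
      exact volume_cubeSet_ne_zero 0 one_pos
    have := ae_neBot.2 hne
    obtain ⟨x, hx⟩ := hae.exists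
    exact ⟨x, hx.ne⟩
  obtain ⟨f, hf⟩ := exists_distribution_of_majorant_ne_top hn (Nat.succ_pos _) hp0 hp1 hlam hatom hx₀
  have hmax : ∀ x, heatMax f x ≤ K₂ * ENNReal.ofReal A * S x ^ (1 / p) := by
    intro x
    refine iSup_le fun t => iSup_le fun ht => ?_
    rw [heat, ← (hf (heatKernel ht x)).tsum_eq]
    exact enorm_tsum_le_tsum_enorm.trans
      (hpair hlam hatom (Real.sqrt_pos.2 ht) ((heatKernel ht x).smooth m) (hA t ht x))
  have hnorm : hardyMorreyNorm (ENNReal.ofReal p) φ f ≤ ENNReal.ofReal (K.toReal + 1) * N := by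
    have hKle : K ≤ ENNReal.ofReal (K.toReal + 1) := by
      rw [← ENNReal.ofReal_toReal hKt]
      exact ENNReal.ofReal_le_ofReal (by simp)
    refine le_trans ?_ (mul_le_mul_left hKle N)
    refine iSup_le fun P => ?_
    refine ENNReal.div_le_of_le_mul ?_
    have hP := P.side_pos
    have hPn0 : ENNReal.ofReal P.side ^ n ≠ 0 := pow_ne_zero _ (by simpa using hP)
    have hle := eLpNorm_cube_eq hp0 (heatMax f) P.center hP
    refine (le_of_eq hle).trans ?_
    rw [one_div, ENNReal.rpow_inv_le_iff hp0, ENNReal.inv_mul_le_iff hPn0 (by finiteness)]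
    calc ∫⁻ x in cubeSet P.center P.side, ‖heatMax f x‖ₑ ^ p
        ≤ ∫⁻ x in cubeSet P.center P.side, (K₂ * ENNReal.ofReal A) ^ p * S x := by
          refine lintegral_mono fun x => ?_
          rw [enorm_eq_self]
          refine (ENNReal.rpow_le_rpow (hmax x) hp0.le).trans (le_of_eq ?_)
          rw [ENNReal.mul_rpow_of_nonneg _ _ hp0.le, ← ENNReal.rpow_mul,
            one_div_mul_cancel hp0.ne', ENNReal.rpow_one]
      _ ≤ (K₂ * ENNReal.ofReal A) ^ p *
          (K₁ * (N ^ p * ENNReal.ofReal (φ P.center P.side) ^ p * ENNReal.ofReal P.side ^ n)) := by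
          rw [lintegral_const_mul _ hSmeas]
          gcongr
          exact hSint _ _ hP
      _ = _ := by
          simp_rw [hK, ENNReal.mul_rpow_of_nonneg _ _ hp0.le]
          rw [← ENNReal.rpow_mul K₁, one_div_mul_cancel hp0.ne', ENNReal.rpow_one]
          ring
  refine ⟨f, fun κ => ?_, ⟨(measurable_heatMax f).aestronglyMeasurable,
    hnorm.trans_lt (ENNReal.mul_lt_top ENNReal.ofReal_lt_top hfin)⟩, hnorm⟩
  refine (hf κ).tendsto_sum_nat.congr fun M => Finset.sum_congr rfl fun j _ => ?_
  simp_rw [mul_assoc]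
  rw [integral_const_mul]
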